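/- Let $\Omega\subset\mathbb R^n$ be a bounded domain and $1<p<\infty$. Let $v\ge 0$ be a weight with $v\in L^1(\Omega)$, and let $Q$ be a measurable $n\times n$ symmetric positive semidefinite matrix function on $\Omega$ with $|Q(x)|_{\mathrm{op}}^{p/2}\le k\,v(x)$ for a.e. $x\in\Omega$, for some constant $k$. Let $\mathrm{Lip}_0(\Omega)$ be the locally Lipschitz functions with compact support in $\Omega$, and put $\|\mathbf h\|_{QL^p(\Omega)}=\big(\int_\Omega|\sqrt Q\,\mathbf h|^p\,dx\big)^{1/p}$ and $$\|h\|_{L^\Phi(v,\Omega)}=\inf\Big\{\lambda>0:\int_\Omega\Phi\big(|h|/\lambda\big)\,v\,dx\le1\Big\},$$ with $h\in L^\Phi(v,\Omega)$ meaning that $h$ is measurable and this quantity is finite. Let $QH^{1,p}_0(v,\Omega)$ be the set of pairs $(u,\nabla u)\in L^p(v,\Omega)\times QL^p(\Omega)$ that are limits in $L^p(v,\Omega)\times QL^p(\Omega)$ of pairs $(\psi_j,\nabla\psi_j)$ with $\psi_j\in\mathrm{Lip}_0(\Omega)$ (here $\nabla u$ denotes the second component of the pair). Let $\sigma>p$ and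 $N(t)=t^p\log(e+t)^\sigma$, and suppose that the Sobolev inequality $$\|\varphi\|_{L^N(v,\Omega)}\le S_N\|\nabla\varphi\|_{QL^p(\Omega)}\qquad\text{for all }\varphi\in\mathrm{Lip}_0(\Omega)$$ holds. Let $\mathbf t:\Omega\to\mathbb R^n$ be measurable and degenerate subunit, that is, $\|\mathbf t\cdot\nabla\varphi\|_{L^p(v,\Omega)}\le C(\mathbf t)\|\nabla\varphi\|_{QL^p(\Omega)}$ for all $\varphi\in\mathrm{Lip}_0(\Omega)$. Let $\alpha>\frac{p(p-1)}{\sigma}$, $\beta>\frac{p}{\sigma-p}$, $A(t)=\exp(t^\alpha)-1$, $B(t)=\exp(t^\beta)-1$, and let $f\in L^A(v,\Omega)$ and $g\in L^B(v,\Omega)$. Consider the Dirichlet problem $$-v^{-1}\mathrm{div}\big(|\sqrt Q\nabla u|^{p-2}Q\nabla u\big)=f|f|^{p-2}-v^{-1}\mathrm{div}\big(v|g|^{p-2}g\,\mathbf t\big)\ \text{ in }\Omega,\qquad u=0\ \text{ on }\partial\Omega.$$ A pair $(u,\nabla u)\in QH_0^{1,p}(v,\Omega)$ is a degenerate weak solution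 of it if $$\int_\Omega|\sqrt Q\nabla u|^{p-2}\,\nabla\varphi\cdot Q\nabla u\,dx=\int_\Omega\big(f|f|^{p-2}\varphi+|g|^{p-2}g\,\mathbf t\cdot\nabla\varphi\big)\,v\,dx$$ for every $\varphi\in\mathrm{Lip}_0(\Omega)$, and a degenerate weak subsolution (supersolution) if this holds with $\le$ ($\ge$) in place of $=$ for every nonnegative $\varphi\in\mathrm{Lip}_0(\Omega)$. Then there is a constant $C$, depending only on $p,\sigma,\alpha,\beta,S_N,C(\mathbf t),\Omega,v$ (and in particular independent of $u$, $f$ and $g$), such that, with $u^+=\max(u,0)$ and $u^-=\max(-u,0)$: every degenerate weak subsolution satisfies $$\|u^+\|_{L^\infty(v,\Omega)}\le C\big(\|f\|_{L^A(v,\Omega)}+\|g\|_{L^B(v,\Omega)}\big);$$ every degenerate weak supersolution satisfies the same bound for $\|u^-\|_{L^\infty(v,\Omega)}$; and every degenerate weak solution belongs to $L^\infty(v,\Omega)$ and satisfies the same bound for $\|u\|_{L^\infty(v,\Omega)}$. -/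

import Mathlib

open scoped ENNReal NNReal MatrixOrder Topology

noncomputable section

namespace DegenerateDirichlet

/-- Euclidean space `ℝⁿ`. -/
abbrev E (n : ℕ) : Type := EuclideanSpace ℝ (Fin n)

variable {n : ℕ}

/-- The measure `v dx` on `Ω`. -/
def wMeasure (Ω : Set (E n)) (v : E n → ℝ) : MeasureTheory.Measure (E n) :=
  (MeasureTheory.volume.restrict Ω).withDensity (fun x => ENNReal.ofReal (v x))

/-- `φ ∈ Lip₀(Ω)`: locally Lipschitz with compact support contained in `Ω`
(functions in `Lip₀(Ω)` are extended by zero to all of `ℝⁿ`). -/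
def IsLipZero (Ω : Set (E n)) (φ : E n → ℝ) : Prop :=
  LocallyLipschitz φ ∧ HasCompactSupport φ ∧ tsupport φ ⊆ Ω

/-- The linear map `ξ ↦ Q ξ` of `ℝⁿ` given by a matrix. -/
def mulVec (Q : Matrix (Fin n) (Fin n) ℝ) : E n →L[ℝ] E n :=
  Matrix.toEuclideanCLM (n := Fin n) (𝕜 := ℝ) Q

/-- The linear map `ξ ↦ √Q ξ`, with `√Q` the positive semidefinite square root of `Q`. -/
def sqrtMulVec (Q : Matrix (Fin n) (Fin n) ℝ) : E n →L[ℝ] E n :=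
  mulVec (CFC.sqrt Q)

/-- The Luxemburg functional
`‖h‖_{L^Φ(μ)} = inf {c > 0 : ∫ Φ(|h| / c) dμ ≤ 1}`, with value `∞` if there is no such `c`. -/
def luxemburgNorm (Φ : ℝ → ℝ) (μ : MeasureTheory.Measure (E n)) (h : E n → ℝ) : ℝ≥0∞ :=
  sInf {r : ℝ≥0∞ | ∃ c : ℝ, 0 < c ∧ r = ENNReal.ofReal c ∧
    ∫⁻ x, ENNReal.ofReal (Φ (|h x| / c)) ∂μ ≤ 1}

/-- `h ∈ L^Φ(μ)`. -/
def MemOrlicz (Φ : ℝ → ℝ) (μ : MeasureTheory.Measure (E n)) (h : E n → ℝ) : Prop :=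
  AEMeasurable h μ ∧ luxemburgNorm Φ μ h < ∞

/-- `N(t) = t^p log(e + t)^σ`. -/
def logBump (p σ : ℝ) (t : ℝ) : ℝ :=
  t ^ p * Real.log (Real.exp 1 + t) ^ σ

/-- `exp(t^α) - 1`. -/
def expYoung (α : ℝ) (t : ℝ) : ℝ :=
  Real.exp (t ^ α) - 1

/-- `‖G‖_{QL^p(Ω)} = (∫_Ω |√Q G|^p dx)^{1/p}`. -/
def QLpNorm (Ω : Set (E n)) (p : ℝ) (Q : E n → Matrix (Fin n) (Fin n) ℝ)
    (G : E n → E n) : ℝ≥0∞ :=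
  MeasureTheory.eLpNorm (fun x => sqrtMulVec (Q x) (G x)) (ENNReal.ofReal p)
    (MeasureTheory.volume.restrict Ω)

/-- `Q` is a measurable, symmetric, positive semidefinite matrix function on `Ω`. -/
def IsPSDMatrixFunction (Ω : Set (E n)) (Q : E n → Matrix (Fin n) (Fin n) ℝ) : Prop :=
  (∀ i j, AEMeasurable (fun x => Q x i j) (MeasureTheory.volume.restrict Ω)) ∧
    ∀ x ∈ Ω, (Q x).PosSemidef

/-- `|Q|_op^{p/2} ≤ k v` almost everywhere in `Ω`. -/
def IsDominated (Ω : Set (E n)) (p : ℝ) (Q : E n → Matrix (Fin n) (Fin n) ℝ) (v : E n → ℝ)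
    (k : ℝ) : Prop :=
  ∀ᵐ x ∂(MeasureTheory.volume.restrict Ω), ‖mulVec (Q x)‖ ^ (p / 2) ≤ k * v x

/-- The Sobolev inequality `‖φ‖_{L^N(v,Ω)} ≤ S ‖∇φ‖_{QL^p(Ω)}` for all `φ ∈ Lip₀(Ω)`. -/
def SobolevInequality (Ω : Set (E n)) (p : ℝ) (Q : E n → Matrix (Fin n) (Fin n) ℝ)
    (v : E n → ℝ) (N : ℝ → ℝ) (S : ℝ≥0) : Prop :=
  ∀ φ : E n → ℝ, IsLipZero Ω φ →
    luxemburgNorm N (wMeasure Ω v) φ ≤ S * QLpNorm Ω p Q (gradient φ)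

/-- `𝐭 · ∇` is a degenerate subunit vector field with constant `K`: `𝐭` is measurable and
`‖𝐭 · ∇φ‖_{L^p(v,Ω)} ≤ K ‖∇φ‖_{QL^p(Ω)}` for all `φ ∈ Lip₀(Ω)`. -/
def IsSubunit (Ω : Set (E n)) (p : ℝ) (Q : E n → Matrix (Fin n) (Fin n) ℝ)
    (v : E n → ℝ) (t : E n → E n) (K : ℝ≥0) : Prop :=
  AEMeasurable t (wMeasure Ω v) ∧
    ∀ φ : E n → ℝ, IsLipZero Ω φ →
      MeasureTheory.eLpNorm (fun x => inner ℝ (t x) (gradient φ x)) (ENNReal.ofReal p)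
        (wMeasure Ω v) ≤ K * QLpNorm Ω p Q (gradient φ)

/-- The pair `(u, G)`, with `G` in the role of `∇u`, belongs to `QH₀^{1,p}(v, Ω)`: it is the limit
in `L^p(v,Ω) × QL^p(Ω)` of pairs `(ψⱼ, ∇ψⱼ)` with `ψⱼ ∈ Lip₀(Ω)`. -/
def MemQH0 (Ω : Set (E n)) (p : ℝ) (Q : E n → Matrix (Fin n) (Fin n) ℝ) (v : E n → ℝ)
    (u : E n → ℝ) (G : E n → E n) : Prop :=
  MeasureTheory.MemLp u (ENNReal.ofReal p) (wMeasure Ω v) ∧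
  AEMeasurable G (MeasureTheory.volume.restrict Ω) ∧
  QLpNorm Ω p Q G < ∞ ∧
  ∃ ψ : ℕ → E n → ℝ, (∀ j, IsLipZero Ω (ψ j)) ∧
    Filter.Tendsto (fun j => MeasureTheory.eLpNorm (fun x => ψ j x - u x) (ENNReal.ofReal p)
      (wMeasure Ω v)) Filter.atTop (𝓝 0) ∧
    Filter.Tendsto (fun j => QLpNorm Ω p Q (fun x => gradient (ψ j) x - G x))
      Filter.atTop (𝓝 0)

/-- The left side of the weak formulation, `∫_Ω |√Q ∇u|^{p-2} ∇φ · Q∇u dx`, with `G = ∇u`. -/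
def weakLHS (Ω : Set (E n)) (p : ℝ) (Q : E n → Matrix (Fin n) (Fin n) ℝ)
    (G : E n → E n) (φ : E n → ℝ) : ℝ :=
  ∫ x in Ω, ‖sqrtMulVec (Q x) (G x)‖ ^ (p - 2) * inner ℝ (gradient φ x) (mulVec (Q x) (G x))

/-- The right side of the weak formulation,
`∫_Ω (f |f|^{p-2} φ + |g|^{p-2} g 𝐭 · ∇φ) v dx`. -/
def weakRHS (Ω : Set (E n)) (p : ℝ) (v f g : E n → ℝ) (t : E n → E n) (φ : E n → ℝ) : ℝ :=
  ∫ x, (f x * |f x| ^ (p - 2) * φ x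
    + |g x| ^ (p - 2) * g x * inner ℝ (t x) (gradient φ x)) ∂(wMeasure Ω v)

/-- `(u, G)` is a degenerate weak solution of the Dirichlet problem
`-v⁻¹ div(|√Q ∇u|^{p-2} Q∇u) = f|f|^{p-2} - v⁻¹ div(v |g|^{p-2} g 𝐭)` in `Ω`, `u = 0` on `∂Ω`. -/
def IsWeakSolution (Ω : Set (E n)) (p : ℝ) (Q : E n → Matrix (Fin n) (Fin n) ℝ)
    (v f g : E n → ℝ) (t : E n → E n) (u : E n → ℝ) (G : E n → E n) : Prop :=
  MemQH0 Ω p Q v u G ∧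
    ∀ φ : E n → ℝ, IsLipZero Ω φ → weakLHS Ω p Q G φ = weakRHS Ω p v f g t φ

/-- `(u, G)` is a degenerate weak subsolution of the Dirichlet problem. -/
def IsWeakSubsolution (Ω : Set (E n)) (p : ℝ) (Q : E n → Matrix (Fin n) (Fin n) ℝ)
    (v f g : E n → ℝ) (t : E n → E n) (u : E n → ℝ) (G : E n → E n) : Prop :=
  MemQH0 Ω p Q v u G ∧
    ∀ φ : E n → ℝ, IsLipZero Ω φ → (∀ x, 0 ≤ φ x) →
      weakLHS Ω p Q G φ ≤ weakRHS Ω p v f g t φ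

/-- `(u, G)` is a degenerate weak supersolution of the Dirichlet problem. -/
def IsWeakSupersolution (Ω : Set (E n)) (p : ℝ) (Q : E n → Matrix (Fin n) (Fin n) ℝ)
    (v f g : E n → ℝ) (t : E n → E n) (u : E n → ℝ) (G : E n → E n) : Prop :=
  MemQH0 Ω p Q v u G ∧
    ∀ φ : E n → ℝ, IsLipZero Ω φ → (∀ x, 0 ≤ φ x) →
      weakRHS Ω p v f g t φ ≤ weakLHS Ω p Q G φ

end DegenerateDirichlet

end

/-!
The bound is a De Giorgi iteration in which the logarithmic bump `N` replaces the power gain of the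
classical Sobolev inequality. Write `μ = v dx`.

*Small sets.* If `μ(A) ≤ m e^{-l}`, a function in `exp L^γ` has `L^p(A)` norm at most a multiple of
`l^{1/γ} e^{-l/p}` (`exists_eLpNorm_le_expYoung`), while a function supported in `A` has `L^p` norm
at most a multiple of `l^{-σ/p}` times its `L^N` norm (`exists_eLpNorm_le_logBump`).

*Energy.* Testing the equation with the truncation `(u - r)⁺` and applying Hölder's inequality to
the data bounds `‖∇(u - r)⁺‖^{p-1}` by the data on `{u > r}`, hence `‖∇(u - r)⁺‖` by a multiple of
`R l^{1/β} e^{-l/p}` when `μ{u > r} ≤ M e^{-(l-1)}` and both Orlicz norms are at most `R`; the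
condition on `α` makes the contribution of `f` no larger than that of `g`. By the Sobolev
inequality and Chebyshev's inequality, raising `r` by a multiple of `R l^{1/β - σ/p}` then lowers
the measure of the superlevel set by the factor `e` (`measure_superlevel_le`). The increments,
summed over `l = 1, 2, …`, converge exactly when `σ/p - 1/β > 1`, that is `β > p/(σ-p)`, so `u` is
bounded above by a multiple of `R` (`exists_measure_superlevel_eq_zero`).

The pair `(u, G)` is only a limit of pairs `(ψⱼ, ∇ψⱼ)`, and `G` need not be determined by `u`, so
no chain rule is available for `(u - r)⁺`. The truncations are therefore applied to the Lipschitz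
functions: `(ψⱼ - r)⁺` is an admissible test function whose gradient is everywhere `∇ψⱼ` on
`{ψⱼ > r}` and zero elsewhere, and the errors `ψⱼ - u` and `∇ψⱼ - G` enter each step only through
quantities that tend to zero. Supersolutions reduce to subsolutions by passing to `(-u, -G)`.
-/

open scoped ENNReal NNReal MatrixOrder Topology

namespace DegenerateDirichlet

open MeasureTheory Filter

/-! ### The square root of a positive semidefinite matrix -/

lemma inner_sqrtMulVec {n : ℕ} {Q : Matrix (Fin n) (Fin n) ℝ} (hQ : Q.PosSemidef) (ξ η : E n) :
    inner ℝ (sqrtMulVec Q ξ) (sqrtMulVec Q η) = inner ℝ ξ (mulVec Q η) := by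
  have h0 : (0 : Matrix (Fin n) (Fin n) ℝ) ≤ Q := Matrix.nonneg_iff_posSemidef.2 hQ
  have hsa : star (CFC.sqrt Q) = CFC.sqrt Q := (CFC.sqrt_nonneg Q).isSelfAdjoint
  have hsq : CFC.sqrt Q * CFC.sqrt Q = Q := CFC.sqrt_mul_sqrt_self Q h0
  have hadj : ContinuousLinearMap.adjoint (sqrtMulVec Q) = sqrtMulVec Q := by
    unfold sqrtMulVec mulVec
    rw [← ContinuousLinearMap.star_eq_adjoint, ← map_star, hsa]
  have hmul : mulVec Q η = sqrtMulVec Q (sqrtMulVec Q η) := by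
    unfold sqrtMulVec mulVec
    conv_lhs => rw [← hsq, map_mul, mul_apply_eq_comp]
  rw [hmul, ← ContinuousLinearMap.adjoint_inner_left (sqrtMulVec Q) (sqrtMulVec Q η) ξ, hadj]

lemma sq_norm_sqrtMulVec {n : ℕ} {Q : Matrix (Fin n) (Fin n) ℝ} (hQ : Q.PosSemidef) (ξ : E n) :
    ‖sqrtMulVec Q ξ‖ ^ 2 = inner ℝ ξ (mulVec Q ξ) := by
  rw [← inner_sqrtMulVec hQ, real_inner_self_eq_norm_sq]

lemma aemeasurable_inner_mulVec {n : ℕ} {ν : Measure (E n)}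
    {Q : E n → Matrix (Fin n) (Fin n) ℝ} (hQ : ∀ i j, AEMeasurable (fun x => Q x i j) ν)
    {F G : E n → E n} (hF : AEMeasurable F ν) (hG : AEMeasurable G ν) :
    AEMeasurable (fun x => inner ℝ (F x) (mulVec (Q x) (G x))) ν := by
  have hc : ∀ {H : E n → E n}, AEMeasurable H ν → ∀ i, AEMeasurable (fun x => H x i) ν :=
    fun hH i => (EuclideanSpace.proj (𝕜 := ℝ) i).continuous.measurable.comp_aemeasurable hH
  simp only [mulVec, Matrix.inner_toEuclideanCLM, dotProduct, Matrix.mulVec]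
  refine Finset.aemeasurable_fun_sum _ fun i _ => (hc hF i).mul ?_
  exact Finset.aemeasurable_fun_sum _ fun j _ => (hQ i j).mul (hc hG j)

/-- Measurability of `|√Q G|` comes from `|√Q G|² = G · Q G`, so that the measurability of
`x ↦ √Q(x)` itself is never needed. -/
lemma aemeasurable_norm_sqrtMulVec {n : ℕ} {Ω : Set (E n)} (hΩ : MeasurableSet Ω)
    {Q : E n → Matrix (Fin n) (Fin n) ℝ} (hQ : IsPSDMatrixFunction Ω Q)
    {G : E n → E n} (hG : AEMeasurable G (volume.restrict Ω)) :
    AEMeasurable (fun x => ‖sqrtMulVec (Q x) (G x)‖) (volume.restrict Ω) := by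
  refine (Real.continuous_sqrt.measurable.comp_aemeasurable
    (aemeasurable_inner_mulVec hQ.1 hG hG)).congr ?_
  filter_upwards [ae_restrict_mem hΩ] with x hx
  simp only [Function.comp]
  rw [← sq_norm_sqrtMulVec (hQ.2 x hx), Real.sqrt_sq (norm_nonneg _)]

/-! ### Truncations of functions in `Lip₀(Ω)` -/

lemma measurable_gradient {n : ℕ} (φ : E n → ℝ) : Measurable (gradient φ) :=
  (InnerProductSpace.toDual ℝ (E n)).symm.continuous.measurable.comp (measurable_fderiv ℝ φ)

lemma IsLipZero.neg {n : ℕ} {Ω : Set (E n)} {φ : E n → ℝ} (h : IsLipZero Ω φ) :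
    IsLipZero Ω (-φ) := by
  refine ⟨h.1.neg, h.2.1.neg, ?_⟩
  have : tsupport (-φ) = tsupport φ := by simp [tsupport, Function.support_neg]
  rw [this]; exact h.2.2

lemma gradient_neg_apply {n : ℕ} (φ : E n → ℝ) (x : E n) :
    gradient (-φ) x = -gradient φ x := by
  simp [gradient, fderiv_neg]

lemma IsLipZero.truncate {n : ℕ} {Ω : Set (E n)} {ψ : E n → ℝ} (h : IsLipZero Ω ψ) {r : ℝ}
    (hr : 0 ≤ r) : IsLipZero Ω (fun x => max (ψ x - r) 0) := by
  have hsupp : tsupport (fun x => max (ψ x - r) 0) ⊆ tsupport ψ := by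
    refine closure_mono fun x hx => ?_
    simp only [Function.mem_support] at hx ⊢
    intro h0
    exact hx (by rw [h0]; simpa using hr)
  refine ⟨(h.1.sub (LocallyLipschitz.const r)).max_const 0, ?_, hsupp.trans h.2.2⟩
  exact h.2.1.of_isClosed_subset (isClosed_tsupport _) hsupp

lemma gradient_truncate_of_lt {n : ℕ} {ψ : E n → ℝ} (hψ : Continuous ψ) {r : ℝ} {x : E n}
    (hx : r < ψ x) : gradient (fun y => max (ψ y - r) 0) x = gradient ψ x := by
  have : (fun y => max (ψ y - r) 0) =ᶠ[𝓝 x] fun y => ψ y - r := by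
    filter_upwards [hψ.continuousAt.eventually (lt_mem_nhds hx)] with y hy
    exact max_eq_left (by linarith)
  simp only [gradient]
  rw [this.fderiv_eq, fderiv_sub_const]

/-- At a point where `(ψ - r)⁺` vanishes it has a minimum, so that its gradient is zero there,
whether or not it is differentiable. -/
lemma gradient_truncate_of_le {n : ℕ} {ψ : E n → ℝ} {r : ℝ} {x : E n}
    (hx : ψ x ≤ r) : gradient (fun y => max (ψ y - r) 0) x = 0 := by
  have : IsLocalMin (fun y => max (ψ y - r) 0) x := by
    refine Eventually.of_forall fun y => ?_
    simp only
    rw [max_eq_right (by linarith : ψ x - r ≤ 0)]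
    exact le_max_right _ _
  simp [gradient, this.fderiv_eq_zero]

/-! ### Orlicz norms on sets of small measure -/

/-- A pointwise bound `w^p ≤ P + q Φ(w)` turns into a bound of the `L^p` norm on a set by the
Luxemburg norm. -/
lemma eLpNorm_restrict_le_luxemburgNorm {n : ℕ} {Φ : ℝ → ℝ} {μ : Measure (E n)} {A : Set (E n)}
    {p P q D : ℝ} (hp : 0 < p) (hq : 0 ≤ q) (hD : 0 < D)
    (hpt : ∀ w, 0 ≤ w → w ^ p ≤ P + q * Φ w)
    (hA : ENNReal.ofReal P * μ A + ENNReal.ofReal q ≤ ENNReal.ofReal D) (h : E n → ℝ) :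
    eLpNorm h (ENNReal.ofReal p) (μ.restrict A) ≤
      ENNReal.ofReal (D ^ (1 / p)) * luxemburgNorm Φ μ h := by
  have hDp : 0 < D ^ (1 / p) := Real.rpow_pos_of_pos hD _
  rw [mul_comm, ← ENNReal.div_le_iff (by simpa using hDp) ENNReal.ofReal_ne_top]
  refine le_sInf ?_
  rintro _ ⟨c, hc, rfl, hint⟩
  rw [ENNReal.div_le_iff (by simpa using hDp) ENNReal.ofReal_ne_top]
  have hp0 : ENNReal.ofReal p ≠ 0 := by simpa using hp
  have key : ∫⁻ x in A, ENNReal.ofReal ((|h x| / c) ^ p) ∂μ ≤ ENNReal.ofReal D := by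
    calc ∫⁻ x in A, ENNReal.ofReal ((|h x| / c) ^ p) ∂μ
        ≤ ∫⁻ x in A, (ENNReal.ofReal P + ENNReal.ofReal q * ENNReal.ofReal (Φ (|h x| / c))) ∂μ := by
          refine lintegral_mono fun x => ?_
          rw [← ENNReal.ofReal_mul hq]
          refine (ENNReal.ofReal_le_ofReal (hpt _ (by positivity))).trans ENNReal.ofReal_add_le
      _ = ENNReal.ofReal P * μ A
            + ENNReal.ofReal q * ∫⁻ x in A, ENNReal.ofReal (Φ (|h x| / c)) ∂μ := by
          rw [lintegral_add_left measurable_const, lintegral_const_mul' _ _ ENNReal.ofReal_ne_top]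
          simp
      _ ≤ ENNReal.ofReal P * μ A + ENNReal.ofReal q * 1 := by
          gcongr
          exact (setLIntegral_le_lintegral _ _).trans hint
      _ ≤ _ := by rwa [mul_one]
  have hpow : ∀ x, ‖h x‖ₑ ^ p = ENNReal.ofReal c ^ p * ENNReal.ofReal ((|h x| / c) ^ p) := by
    intro x
    rw [← ENNReal.ofReal_rpow_of_nonneg (by positivity) hp.le,
      ← ENNReal.mul_rpow_of_nonneg _ _ hp.le, ← ENNReal.ofReal_mul hc.le,
      mul_div_cancel₀ _ hc.ne', Real.enorm_eq_ofReal_abs]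
  rw [eLpNorm_eq_lintegral_rpow_enorm_toReal hp0 ENNReal.ofReal_ne_top,
    ENNReal.toReal_ofReal hp.le]
  simp_rw [hpow]
  rw [lintegral_const_mul' _ _ (by simp [hp.le]), ENNReal.mul_rpow_of_nonneg _ _ (by positivity),
    ← ENNReal.rpow_mul, mul_one_div_cancel hp.ne', ENNReal.rpow_one]
  gcongr
  rw [← ENNReal.ofReal_rpow_of_nonneg hD.le (by positivity)]
  gcongr

lemma rpow_le_mul_exp {s b x : ℝ} (hs : 0 < s) (hb : 0 < b) (hx : 0 ≤ x) :
    x ^ s ≤ (s / b) ^ s * Real.exp (b * x) := by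
  have h1 : x ≤ (s / b) * Real.exp (b * x / s) := by
    have h2 : b * x / s ≤ Real.exp (b * x / s) := by linarith [Real.add_one_le_exp (b * x / s)]
    calc x = (s / b) * (b * x / s) := by field_simp
      _ ≤ _ := by gcongr
  calc x ^ s ≤ ((s / b) * Real.exp (b * x / s)) ^ s := by gcongr
    _ = _ := by
      rw [Real.mul_rpow (by positivity) (by positivity), ← Real.exp_mul]
      congr 2
      field_simp

/-- On a set of measure at most `m e^{-l}` the `L^p` norm of a function in `exp L^γ` is at most a
multiple of `l^{1/γ} e^{-l/p}`. -/
lemma exists_eLpNorm_le_expYoung {p γ m : ℝ} (hp : 0 < p) (hγ : 0 < γ) (hm : 0 < m) :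
    ∃ C : ℝ, 0 < C ∧ ∀ (n : ℕ) (μ : Measure (E n)) (A : Set (E n)) (l : ℝ) (h : E n → ℝ),
      1 ≤ l → μ A ≤ ENNReal.ofReal (m * Real.exp (-l)) →
      eLpNorm h (ENNReal.ofReal p) (μ.restrict A) ≤
        ENNReal.ofReal (C * l ^ (1 / γ) * Real.exp (-l / p)) *
          luxemburgNorm (expYoung γ) μ h := by
  set s := p / γ with hs
  have hs0 : 0 < s := by positivity
  -- `a` is the constant in `y ^ s ≤ a * exp (y / 2)`
  set a := (s / (1 / 2 : ℝ)) ^ s with ha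
  have ha0 : 0 < a := by positivity
  have hpy : ∀ w : ℝ, 0 ≤ w → w ^ p = (w ^ γ) ^ s := fun w hw => by
    rw [← Real.rpow_mul hw, hs, mul_div_cancel₀ _ hγ.ne']
  refine ⟨(((2 : ℝ) ^ s + a) * m + a) ^ (1 / p), by positivity, ?_⟩
  intro n μ A l h hl hA
  have hl0 : 0 < l := by linarith
  have hls : (1 : ℝ) ≤ l ^ s := Real.one_le_rpow hl hs0.le
  have hexp : Real.exp (-l) ≤ 1 := Real.exp_le_one_iff.2 (by linarith)
  have hpt : ∀ w : ℝ, 0 ≤ w →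
      w ^ p ≤ ((2 * l) ^ s + a * Real.exp (-l)) + (a * Real.exp (-l)) * expYoung γ w := by
    intro w hw
    have hy : 0 ≤ w ^ γ := by positivity
    have hsplit : ((2 * l) ^ s + a * Real.exp (-l)) + (a * Real.exp (-l)) * expYoung γ w
        = (2 * l) ^ s + a * Real.exp (w ^ γ - l) := by
      rw [expYoung, sub_eq_add_neg (w ^ γ) l, Real.exp_add]; ring
    rw [hsplit, hpy w hw]
    rcases le_total (w ^ γ) (2 * l) with h1 | h1
    · have : (w ^ γ) ^ s ≤ (2 * l) ^ s := by gcongr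
      have : 0 ≤ a * Real.exp (w ^ γ - l) := by positivity
      linarith
    · have h2 := rpow_le_mul_exp hs0 (by norm_num : (0 : ℝ) < 1 / 2) hy
      rw [← ha] at h2
      have h3 : Real.exp (1 / 2 * w ^ γ) ≤ Real.exp (w ^ γ - l) := Real.exp_le_exp.2 (by linarith)
      have h4 : a * Real.exp (1 / 2 * w ^ γ) ≤ a * Real.exp (w ^ γ - l) := by gcongr
      have : 0 ≤ (2 * l) ^ s := by positivity
      linarith
  have key := eLpNorm_restrict_le_luxemburgNorm (μ := μ) (A := A)
    (D := (((2 : ℝ) ^ s + a) * m + a) * (l ^ s * Real.exp (-l))) hp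
    (by positivity) (by positivity) hpt ?_ h
  · refine key.trans_eq ?_
    congr 2
    rw [Real.mul_rpow (by positivity) (by positivity), Real.mul_rpow (by positivity)
      (by positivity), ← Real.exp_mul, ← Real.rpow_mul hl0.le, mul_assoc]
    congr 3
    · rw [hs]; field_simp
    · ring
  · calc ENNReal.ofReal ((2 * l) ^ s + a * Real.exp (-l)) * μ A
          + ENNReal.ofReal (a * Real.exp (-l))
        ≤ ENNReal.ofReal ((2 * l) ^ s + a * Real.exp (-l)) * ENNReal.ofReal (m * Real.exp (-l))
          + ENNReal.ofReal (a * Real.exp (-l)) := by gcongr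
      _ = ENNReal.ofReal (((2 * l) ^ s + a * Real.exp (-l)) * (m * Real.exp (-l))
          + a * Real.exp (-l)) := by
          rw [← ENNReal.ofReal_mul (by positivity), ← ENNReal.ofReal_add (by positivity)
            (by positivity)]
      _ ≤ _ := by
          refine ENNReal.ofReal_le_ofReal ?_
          rw [Real.mul_rpow (by norm_num) hl0.le]
          have h1 : a * Real.exp (-l) ≤ a * l ^ s := by gcongr; linarith
          have h2 : a * 1 ≤ a * l ^ s := by gcongr
          calc ((2 : ℝ) ^ s * l ^ s + a * Real.exp (-l)) * (m * Real.exp (-l)) + a * Real.exp (-l)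
              ≤ ((2 : ℝ) ^ s * l ^ s + a * l ^ s) * (m * Real.exp (-l))
                + (a * l ^ s) * Real.exp (-l) := by
                gcongr
                linarith
            _ = _ := by ring

/-- A function supported in a set of measure at most `m e^{-l}` has `L^p` norm at most a multiple
of `l^{-σ/p}` times its norm in `L^N`: this is the gain of the logarithmic bump. -/
lemma exists_eLpNorm_le_logBump {p σ m : ℝ} (hp : 0 < p) (hσ : 0 < σ) (hm : 0 < m) :
    ∃ C : ℝ, 0 < C ∧ ∀ (n : ℕ) (μ : Measure (E n)) (A : Set (E n)) (l : ℝ) (h : E n → ℝ),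
      0 < l → μ A ≤ ENNReal.ofReal (m * Real.exp (-l)) →
      eLpNorm h (ENNReal.ofReal p) (μ.restrict A) ≤
        ENNReal.ofReal (C * l ^ (-σ / p)) * luxemburgNorm (logBump p σ) μ h := by
  set a := (σ / (1 / 2 : ℝ)) ^ σ with ha
  have ha0 : 0 < a := by positivity
  refine ⟨(m * a + (2 * p) ^ σ) ^ (1 / p), by positivity, ?_⟩
  intro n μ A l h hl hA
  -- the two ranges of `w` are separated at `w = exp (l / (2 * p))`
  have hpt : ∀ w : ℝ, 0 ≤ w →
      w ^ p ≤ Real.exp (l / 2) + (2 * p / l) ^ σ * logBump p σ w := by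
    intro w hw
    have he : (1 : ℝ) ≤ Real.exp 1 + w := by
      linarith [Real.add_one_le_exp (1 : ℝ)]
    have hlog : 0 ≤ Real.log (Real.exp 1 + w) := Real.log_nonneg he
    rcases le_total w (Real.exp (l / (2 * p))) with h1 | h1
    · have h2 : w ^ p ≤ Real.exp (l / (2 * p)) ^ p := by gcongr
      rw [← Real.exp_mul] at h2
      have h3 : l / (2 * p) * p = l / 2 := by field_simp
      rw [h3] at h2
      have : 0 ≤ (2 * p / l) ^ σ * logBump p σ w := by unfold logBump; positivity
      linarith
    · have h2 : l / (2 * p) ≤ Real.log (Real.exp 1 + w) := by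
        rw [Real.le_log_iff_exp_le (by linarith)]
        linarith [Real.exp_pos (1 : ℝ)]
      have h3 : 1 ≤ (2 * p / l) ^ σ * Real.log (Real.exp 1 + w) ^ σ := by
        rw [← Real.mul_rpow (by positivity) hlog]
        refine Real.one_le_rpow ?_ hσ.le
        calc (1 : ℝ) = (2 * p / l) * (l / (2 * p)) := by field_simp
          _ ≤ _ := by gcongr
      have h4 : w ^ p * 1 ≤ w ^ p * ((2 * p / l) ^ σ * Real.log (Real.exp 1 + w) ^ σ) := by gcongr
      have : 0 ≤ Real.exp (l / 2) := by positivity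
      unfold logBump
      linarith
  have key := eLpNorm_restrict_le_luxemburgNorm (μ := μ) (A := A)
    (D := (m * a + (2 * p) ^ σ) * l ^ (-σ)) hp
    (by positivity) (by positivity) hpt ?_ h
  · refine key.trans_eq ?_
    congr 2
    rw [Real.mul_rpow (by positivity) (by positivity), ← Real.rpow_mul hl.le]
    congr 2
    ring
  · calc ENNReal.ofReal (Real.exp (l / 2)) * μ A + ENNReal.ofReal ((2 * p / l) ^ σ)
        ≤ ENNReal.ofReal (Real.exp (l / 2)) * ENNReal.ofReal (m * Real.exp (-l))
          + ENNReal.ofReal ((2 * p / l) ^ σ) := by gcongr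
      _ = ENNReal.ofReal (Real.exp (l / 2) * (m * Real.exp (-l)) + (2 * p / l) ^ σ) := by
          rw [← ENNReal.ofReal_mul (by positivity), ← ENNReal.ofReal_add (by positivity)
            (by positivity)]
      _ ≤ _ := by
          refine ENNReal.ofReal_le_ofReal ?_
          have h1 := rpow_le_mul_exp hσ (by norm_num : (0 : ℝ) < 1 / 2) hl.le
          have h2 : Real.exp (l / 2) * Real.exp (-l) = (Real.exp (1 / 2 * l))⁻¹ := by
            rw [← Real.exp_add, ← Real.exp_neg]; ring_nf
          have h3 : (Real.exp (1 / 2 * l))⁻¹ ≤ a * l ^ (-σ) := by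
            rw [Real.rpow_neg hl.le, inv_le_iff_one_le_mul₀ (by positivity)]
            calc (1 : ℝ) = l ^ σ * (l ^ σ)⁻¹ := (mul_inv_cancel₀ (by positivity)).symm
              _ ≤ (a * Real.exp (1 / 2 * l)) * (l ^ σ)⁻¹ := by gcongr
              _ = _ := by ring
          have h4 : Real.exp (l / 2) * (m * Real.exp (-l)) ≤ m * (a * l ^ (-σ)) := by
            calc Real.exp (l / 2) * (m * Real.exp (-l))
                = m * (Real.exp (l / 2) * Real.exp (-l)) := by ring
              _ ≤ _ := by rw [h2]; gcongr
          rw [Real.div_rpow (by positivity) hl.le, div_eq_mul_inv ((2 * p) ^ σ),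
            ← Real.rpow_neg hl.le]
          linarith

/-- If `X^p ≤ b^{p-1} x + e` and `x ≤ X + d` with small errors `d`, `e`, then `x ≲ b`. -/
lemma le_of_rpow_le_mul_add {p b x X d e : ℝ} (hp : 1 < p) (hb : 0 < b)
    (hd : d ≤ b / 2) (he : e ≤ b ^ p) (h1 : X ^ p ≤ b ^ (p - 1) * x + e) (h2 : x ≤ X + d) :
    x ≤ (2 : ℝ) ^ ((p + 1) / (p - 1)) * b := by
  have hp1 : 0 < p - 1 := by linarith
  by_contra! hx
  set L := (2 : ℝ) ^ ((p + 1) / (p - 1)) with hL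
  have hL1 : 1 ≤ L := Real.one_le_rpow (by norm_num) (by positivity)
  have hbx : b < x := lt_of_le_of_lt (by nlinarith) hx
  have hx0 : 0 < x := hb.trans hbx
  have h3 : (x / 2) ^ p ≤ X ^ p := by
    gcongr
    linarith
  have h4 : b ^ p = b ^ (p - 1) * b := by
    rw [← Real.rpow_add_one hb.ne', sub_add_cancel]
  have h5 : b ^ (p - 1) * b ≤ b ^ (p - 1) * x := by gcongr
  have h6 : (x / 2) ^ p ≤ 2 * b ^ (p - 1) * x := by linarith
  have h7 : x ^ p = x ^ (p - 1) * x := by rw [← Real.rpow_add_one hx0.ne', sub_add_cancel]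
  rw [Real.div_rpow hx0.le (by norm_num), h7, div_le_iff₀ (by positivity)] at h6
  have h8 : x ^ (p - 1) ≤ (2 * 2 ^ p) * b ^ (p - 1) := by
    refine le_of_mul_le_mul_right (h6.trans_eq ?_) hx0
    ring
  have h9 : (L * b) ^ (p - 1) = (2 * 2 ^ p) * b ^ (p - 1) := by
    rw [Real.mul_rpow (by positivity) hb.le, hL, ← Real.rpow_mul (by norm_num),
      div_mul_cancel₀ _ hp1.ne', Real.rpow_add (by norm_num), Real.rpow_one]
    ring
  have h10 : (L * b) ^ (p - 1) < x ^ (p - 1) := by gcongr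
  linarith

/-! ### The energy inequality for truncations -/

lemma lintegral_rpow_sub_one_mul_le {X : Type*} [MeasurableSpace X] {μ : Measure X} {p : ℝ}
    (hp : 1 < p) {f h : X → ℝ} (hf : AEMeasurable f μ) (hh : AEMeasurable h μ) :
    ∫⁻ x, ‖f x‖ₑ ^ (p - 1) * ‖h x‖ₑ ∂μ ≤
      eLpNorm f (ENNReal.ofReal p) μ ^ (p - 1) * eLpNorm h (ENNReal.ofReal p) μ := by
  have hp0 : 0 < p := by linarith
  have hp1 : 0 < p - 1 := by linarith
  have hpq : (p / (p - 1)).HolderConjugate p :=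
    (Real.HolderConjugate.conjExponent hp).symm
  have key := ENNReal.lintegral_mul_le_Lp_mul_Lq μ hpq (hf.enorm.pow_const (p - 1)) hh.enorm
  simp only [Pi.mul_apply] at key
  refine key.trans_eq ?_
  have hp0' : ENNReal.ofReal p ≠ 0 := by simpa using hp0
  rw [eLpNorm_eq_lintegral_rpow_enorm_toReal hp0' ENNReal.ofReal_ne_top,
    eLpNorm_eq_lintegral_rpow_enorm_toReal hp0' ENNReal.ofReal_ne_top,
    ENNReal.toReal_ofReal hp0.le, ← ENNReal.rpow_mul]
  congr 2
  · refine lintegral_congr fun x => ?_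
    rw [← ENNReal.rpow_mul]
    congr 1
    field_simp
  · field_simp

/-- The nonnegative majorant `∫ (|f|^{p-1} |φ| + |g|^{p-1} |𝐭 · ∇φ|) v dx` of `|weakRHS|`; unlike
`weakRHS` it needs no integrability to be meaningful. -/
noncomputable def forcing {n : ℕ} (Ω : Set (E n)) (p : ℝ) (v f g : E n → ℝ) (t : E n → E n) (φ : E n → ℝ) : ℝ≥0∞ :=
  ∫⁻ x, (‖f x‖ₑ ^ (p - 1) * ‖φ x‖ₑ + ‖g x‖ₑ ^ (p - 1) * ‖inner ℝ (t x) (gradient φ x)‖ₑ)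
    ∂(wMeasure Ω v)

lemma enorm_mul_rpow_sub_two {p : ℝ} (hp : 1 < p) (a : ℝ) :
    ‖a * |a| ^ (p - 2)‖ₑ = ‖a‖ₑ ^ (p - 1) := by
  have h : |a| * |a| ^ (p - 2) = |a| ^ (p - 1) := by
    rcases eq_or_ne a 0 with rfl | ha
    · simp [Real.zero_rpow (by linarith : p - 1 ≠ 0)]
    · rw [mul_comm, ← Real.rpow_add_one (abs_ne_zero.2 ha)]
      ring_nf
  rw [Real.enorm_eq_ofReal_abs, Real.enorm_eq_ofReal_abs, abs_mul,
    abs_of_nonneg (Real.rpow_nonneg (abs_nonneg a) (p - 2)), h,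
    ENNReal.ofReal_rpow_of_nonneg (abs_nonneg _) (by linarith)]

lemma enorm_weakRHS_le_forcing {n : ℕ} {Ω : Set (E n)} {p : ℝ} (hp : 1 < p) (v f g : E n → ℝ)
    (t : E n → E n) (φ : E n → ℝ) :
    ‖weakRHS Ω p v f g t φ‖ₑ ≤ forcing Ω p v f g t φ := by
  refine (enorm_integral_le_lintegral_enorm _).trans (lintegral_mono fun x => ?_)
  refine (enorm_add_le _ _).trans_eq ?_
  rw [enorm_mul, enorm_mul (_ * _), enorm_mul_rpow_sub_two hp, mul_comm (|g x| ^ (p - 2)),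
    enorm_mul_rpow_sub_two hp]

lemma forcing_le {n : ℕ} {Ω : Set (E n)} {p : ℝ} (hp : 1 < p) {v f g : E n → ℝ}
    {t : E n → E n} {φ : E n → ℝ} {A : Set (E n)}
    (hf : AEMeasurable f (wMeasure Ω v)) (hg : AEMeasurable g (wMeasure Ω v))
    (ht : AEMeasurable t (wMeasure Ω v)) (hφ : Continuous φ)
    (h0 : ∀ x ∉ A, φ x = 0) (h1 : ∀ x ∉ A, gradient φ x = 0) :
    forcing Ω p v f g t φ ≤
      eLpNorm f (ENNReal.ofReal p) ((wMeasure Ω v).restrict A) ^ (p - 1)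
          * eLpNorm φ (ENNReal.ofReal p) (wMeasure Ω v)
        + eLpNorm g (ENNReal.ofReal p) ((wMeasure Ω v).restrict A) ^ (p - 1)
          * eLpNorm (fun x => inner ℝ (t x) (gradient φ x)) (ENNReal.ofReal p)
              (wMeasure Ω v) := by
  have hmt : AEMeasurable (fun x => inner ℝ (t x) (gradient φ x)) (wMeasure Ω v) :=
    ht.inner (measurable_gradient φ).aemeasurable
  have hres : forcing Ω p v f g t φ = ∫⁻ x in A, (‖f x‖ₑ ^ (p - 1) * ‖φ x‖ₑ
      + ‖g x‖ₑ ^ (p - 1) * ‖inner ℝ (t x) (gradient φ x)‖ₑ) ∂(wMeasure Ω v) := by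
    unfold forcing
    refine (setLIntegral_eq_of_support_subset ?_).symm
    intro x hx
    by_contra hxA
    exact hx (by simp [h0 x hxA, h1 x hxA])
  have hmf : AEMeasurable (fun x => ‖f x‖ₑ ^ (p - 1) * ‖φ x‖ₑ) ((wMeasure Ω v).restrict A) :=
    (hf.restrict.enorm.pow_const _).mul hφ.measurable.enorm.aemeasurable
  rw [hres, lintegral_add_left' hmf]
  refine add_le_add ?_ ?_
  · refine (lintegral_rpow_sub_one_mul_le hp hf.restrict hφ.measurable.aemeasurable).trans ?_
    gcongr
    exact Measure.restrict_le_self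
  · refine (lintegral_rpow_sub_one_mul_le hp hg.restrict hmt.restrict).trans ?_
    gcongr
    exact Measure.restrict_le_self

section Truncation

variable {n : ℕ} {Ω : Set (E n)} {p : ℝ} {Q : E n → Matrix (Fin n) (Fin n) ℝ} {G : E n → E n}
  {ψ : E n → ℝ}

lemma gradient_truncate_eq_indicator (hψ : Continuous ψ) (r : ℝ) :
    gradient (fun y => max (ψ y - r) 0) = {x | r < ψ x}.indicator (gradient ψ) := by
  funext x
  by_cases hx : r < ψ x
  · rw [Set.indicator_of_mem (by exact hx), gradient_truncate_of_lt hψ hx]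
  · rw [Set.indicator_of_notMem (by exact hx), gradient_truncate_of_le (not_lt.1 hx)]

lemma QLpNorm_eq_eLpNorm_norm (G : E n → E n) :
    QLpNorm Ω p Q G = eLpNorm (fun x => ‖sqrtMulVec (Q x) (G x)‖) (ENNReal.ofReal p)
      (volume.restrict Ω) :=
  (eLpNorm_norm _).symm

/-- Minkowski's inequality on the superlevel set `{ψ > r}`. -/
lemma QLpNorm_gradient_truncate_le (hΩ : MeasurableSet Ω) (hp : 1 < p)
    (hQ : IsPSDMatrixFunction Ω Q) (hG : AEMeasurable G (volume.restrict Ω))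
    (hψ : Continuous ψ) (r : ℝ) :
    QLpNorm Ω p Q (gradient (fun y => max (ψ y - r) 0)) ≤
      eLpNorm (fun x => ‖sqrtMulVec (Q x) (G x)‖) (ENNReal.ofReal p)
          ((volume.restrict Ω).restrict {x | r < ψ x})
        + QLpNorm Ω p Q (fun x => gradient ψ x - G x) := by
  have hA : MeasurableSet {x | r < ψ x} := (isOpen_lt continuous_const hψ).measurableSet
  have hp1 : (1 : ℝ≥0∞) ≤ ENNReal.ofReal p := by simpa using hp.le
  have hind : (fun x => sqrtMulVec (Q x) ({x | r < ψ x}.indicator (gradient ψ) x)) =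
      {x | r < ψ x}.indicator (fun x => sqrtMulVec (Q x) (gradient ψ x)) := by
    funext x
    by_cases hx : x ∈ {x | r < ψ x}
    · simp only [Set.indicator_of_mem hx]
    · simp only [Set.indicator_of_notMem hx, map_zero]
  have hd : AEMeasurable (fun x => ‖sqrtMulVec (Q x) (gradient ψ x - G x)‖)
      (volume.restrict Ω) :=
    aemeasurable_norm_sqrtMulVec hΩ hQ ((measurable_gradient ψ).aemeasurable.sub hG)
  have ha := aemeasurable_norm_sqrtMulVec hΩ hQ hG
  rw [gradient_truncate_eq_indicator hψ, QLpNorm, hind, eLpNorm_indicator_eq_eLpNorm_restrict hA]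
  calc eLpNorm (fun x => sqrtMulVec (Q x) (gradient ψ x)) (ENNReal.ofReal p)
        ((volume.restrict Ω).restrict {x | r < ψ x})
      ≤ eLpNorm ((fun x => ‖sqrtMulVec (Q x) (G x)‖)
          + fun x => ‖sqrtMulVec (Q x) (gradient ψ x - G x)‖) (ENNReal.ofReal p)
          ((volume.restrict Ω).restrict {x | r < ψ x}) := by
        refine eLpNorm_mono_real fun x => ?_
        have : sqrtMulVec (Q x) (gradient ψ x)
            = sqrtMulVec (Q x) (G x) + sqrtMulVec (Q x) (gradient ψ x - G x) := by
          rw [← map_add]; congr 1; abel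
        rw [this]
        exact norm_add_le _ _
    _ ≤ _ := eLpNorm_add_le ha.restrict.aestronglyMeasurable hd.restrict.aestronglyMeasurable hp1
    _ ≤ _ := by
        rw [QLpNorm_eq_eLpNorm_norm]
        exact add_le_add_right (eLpNorm_mono_measure _ Measure.restrict_le_self) _

/-- The energy of `G` on `{ψ > r}` is controlled by the weak form tested with `(ψ - r)⁺`, up to
the distance from `∇ψ` to `G`. -/
lemma eLpNorm_rpow_le_weakLHS_add (hΩ : MeasurableSet Ω) (hp : 1 < p)
    (hQ : IsPSDMatrixFunction Ω Q) (hG : AEMeasurable G (volume.restrict Ω))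
    (hψ : Continuous ψ) (hGfin : QLpNorm Ω p Q G < ∞)
    (hd_fin : QLpNorm Ω p Q (fun x => gradient ψ x - G x) < ∞) (r : ℝ) :
    eLpNorm (fun x => ‖sqrtMulVec (Q x) (G x)‖) (ENNReal.ofReal p)
        ((volume.restrict Ω).restrict {x | r < ψ x}) ^ p ≤
      ENNReal.ofReal (weakLHS Ω p Q G (fun y => max (ψ y - r) 0))
        + QLpNorm Ω p Q G ^ (p - 1) * QLpNorm Ω p Q (fun x => gradient ψ x - G x) := by
  have hp0 : 0 < p := by linarith
  have hp1 : 0 < p - 1 := by linarith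
  have hA : MeasurableSet {x | r < ψ x} := (isOpen_lt continuous_const hψ).measurableSet
  have hdm : AEMeasurable (fun x => ‖sqrtMulVec (Q x) (gradient ψ x - G x)‖)
      (volume.restrict Ω) :=
    aemeasurable_norm_sqrtMulVec hΩ hQ ((measurable_gradient ψ).aemeasurable.sub hG)
  have ham := aemeasurable_norm_sqrtMulVec hΩ hQ hG
  set φ : E n → ℝ := fun y => max (ψ y - r) 0 with hφ
  set ν := volume.restrict Ω with hν
  set a : E n → ℝ := fun x => ‖sqrtMulVec (Q x) (G x)‖ with ha
  set d : E n → ℝ := fun x => ‖sqrtMulVec (Q x) (gradient ψ x - G x)‖ with hd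
  set F : E n → ℝ := fun x =>
    ‖sqrtMulVec (Q x) (G x)‖ ^ (p - 2) * inner ℝ (gradient φ x) (mulVec (Q x) (G x)) with hF
  have ha0 : ∀ x, 0 ≤ a x := fun x => norm_nonneg _
  have hd0 : ∀ x, 0 ≤ d x := fun x => norm_nonneg _
  have hQG : QLpNorm Ω p Q G = eLpNorm a (ENNReal.ofReal p) ν := QLpNorm_eq_eLpNorm_norm _
  have hQd : QLpNorm Ω p Q (fun x => gradient ψ x - G x) = eLpNorm d (ENNReal.ofReal p) ν :=
    QLpNorm_eq_eLpNorm_norm _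
  rw [hQG] at hGfin ⊢
  rw [hQd] at hd_fin ⊢
  -- Hölder's inequality for the products `a^{p-1} w` with `w ∈ L^p`
  have hHol : ∀ w : E n → ℝ, AEMeasurable w ν → (∀ x, 0 ≤ w x) →
      ∫⁻ x, ENNReal.ofReal (a x ^ (p - 1) * w x) ∂ν ≤
        eLpNorm a (ENNReal.ofReal p) ν ^ (p - 1) * eLpNorm w (ENNReal.ofReal p) ν := by
    intro w hw hw0
    refine le_trans (lintegral_mono fun x => ?_) (lintegral_rpow_sub_one_mul_le hp ham hw)
    rw [ENNReal.ofReal_mul (by have := ha0 x; positivity),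
      ← ENNReal.ofReal_rpow_of_nonneg (ha0 x) hp1.le, Real.enorm_of_nonneg (ha0 x),
      Real.enorm_of_nonneg (hw0 x)]
  have hint : ∀ w : E n → ℝ, AEMeasurable w ν → (∀ x, 0 ≤ w x) →
      eLpNorm w (ENNReal.ofReal p) ν < ∞ → Integrable (fun x => a x ^ (p - 1) * w x) ν := by
    intro w hw hw0 hwf
    refine ⟨((ham.pow_const _).mul hw).aestronglyMeasurable, ?_⟩
    rw [hasFiniteIntegral_iff_ofReal (ae_of_all _ fun x => by
      have := ha0 x; have := hw0 x; positivity)]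
    exact (hHol w hw hw0).trans_lt
      (ENNReal.mul_lt_top (ENNReal.rpow_lt_top_of_nonneg hp1.le hGfin.ne) hwf)
  have hint_d := hint d hdm hd0 hd_fin
  have hint_a := hint a ham ha0 hGfin
  have hpow : ∀ y : ℝ, 0 ≤ y → y ^ (p - 2) * y = y ^ (p - 1) := by
    intro y hy
    rcases hy.eq_or_lt with rfl | hy
    · simp [Real.zero_rpow hp1.ne']
    · rw [← Real.rpow_add_one hy.ne']; ring_nf
  have hpow' : ∀ y : ℝ, 0 ≤ y → y ^ (p - 1) * y = y ^ p := by
    intro y hy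
    rcases hy.eq_or_lt with rfl | hy
    · simp [Real.zero_rpow hp0.ne']
    · rw [← Real.rpow_add_one hy.ne']; ring_nf
  -- on the superlevel set `F = a^{p-2} (a² + √Q(∇ψ - G) · √Q G)`, elsewhere `F = 0`
  have hFA : ∀ x ∈ Ω, r < ψ x → |F x - a x ^ p| ≤ a x ^ (p - 1) * d x := by
    intro x hx hxr
    have h1 : inner ℝ (gradient φ x) (mulVec (Q x) (G x))
        = inner ℝ (sqrtMulVec (Q x) (gradient ψ x - G x)) (sqrtMulVec (Q x) (G x))
          + a x * a x := by
      rw [gradient_truncate_of_lt hψ hxr, ← inner_sqrtMulVec (hQ.2 x hx),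
        ← real_inner_self_eq_norm_mul_norm, ← inner_add_left, ← map_add, sub_add_cancel]
    have h2 : F x - a x ^ p = a x ^ (p - 2) *
        inner ℝ (sqrtMulVec (Q x) (gradient ψ x - G x)) (sqrtMulVec (Q x) (G x)) := by
      simp only [hF]
      rw [h1, ← hpow' _ (ha0 x), ← hpow _ (ha0 x)]
      ring
    have h3 := abs_real_inner_le_norm (sqrtMulVec (Q x) (gradient ψ x - G x))
      (sqrtMulVec (Q x) (G x))
    have h4 : 0 ≤ a x ^ (p - 2) := Real.rpow_nonneg (ha0 x) _
    rw [h2, abs_mul, abs_of_nonneg h4, ← hpow _ (ha0 x)]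
    calc a x ^ (p - 2) *
          |inner ℝ (sqrtMulVec (Q x) (gradient ψ x - G x)) (sqrtMulVec (Q x) (G x))|
        ≤ a x ^ (p - 2) * (d x * a x) := by gcongr
      _ = _ := by ring
  have hF0 : ∀ x, ¬ r < ψ x → F x = 0 := by
    intro x hxr
    simp only [hF]
    rw [gradient_truncate_of_le (not_lt.1 hxr), inner_zero_left, mul_zero]
  have hFint : Integrable F ν := by
    refine (hint_a.add hint_d).mono' ?_ ?_
    · exact ((ham.pow_const _).mul (aemeasurable_inner_mulVec hQ.1
        (measurable_gradient φ).aemeasurable hG)).aestronglyMeasurable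
    · filter_upwards [ae_restrict_mem hΩ] with x hx
      have h1 : 0 ≤ a x ^ (p - 1) * d x := by have := ha0 x; have := hd0 x; positivity
      have h2 : 0 ≤ a x ^ p := Real.rpow_nonneg (ha0 x) _
      simp only [Pi.add_apply, hpow' _ (ha0 x), Real.norm_eq_abs]
      by_cases hxr : r < ψ x
      · have h3 := abs_le.1 (hFA x hx hxr)
        rw [abs_le]
        constructor <;> linarith [h3.1, h3.2]
      · rw [hF0 x hxr, abs_zero]; positivity
  have hlow : ∀ᵐ x ∂ν, {x | r < ψ x}.indicator (fun x => a x ^ p) x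
      ≤ F x + a x ^ (p - 1) * d x := by
    filter_upwards [ae_restrict_mem hΩ] with x hx
    by_cases hxr : r < ψ x
    · rw [Set.indicator_of_mem (by exact hxr)]
      linarith [(abs_le.1 (hFA x hx hxr)).1]
    · rw [Set.indicator_of_notMem (by exact hxr), hF0 x hxr, zero_add]
      have := ha0 x; have := hd0 x; positivity
  have hp0' : ENNReal.ofReal p ≠ 0 := by simpa using hp0
  calc eLpNorm a (ENNReal.ofReal p) (ν.restrict {x | r < ψ x}) ^ p
      = ∫⁻ x in {x | r < ψ x}, ‖a x‖ₑ ^ p ∂ν := by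
        rw [eLpNorm_eq_lintegral_rpow_enorm_toReal hp0' ENNReal.ofReal_ne_top,
          ENNReal.toReal_ofReal hp0.le, ← ENNReal.rpow_mul, one_div_mul_cancel hp0.ne',
          ENNReal.rpow_one]
    _ = ∫⁻ x, ENNReal.ofReal ({x | r < ψ x}.indicator (fun x => a x ^ p) x) ∂ν := by
        rw [← lintegral_indicator hA]
        refine lintegral_congr fun x => ?_
        by_cases hx : x ∈ {x | r < ψ x}
        · rw [Set.indicator_of_mem hx, Set.indicator_of_mem hx, Real.enorm_of_nonneg (ha0 x),
            ENNReal.ofReal_rpow_of_nonneg (ha0 x) hp0.le]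
        · rw [Set.indicator_of_notMem hx, Set.indicator_of_notMem hx, ENNReal.ofReal_zero]
    _ ≤ ∫⁻ x, ENNReal.ofReal (F x + a x ^ (p - 1) * d x) ∂ν := by
        refine lintegral_mono_ae ?_
        filter_upwards [hlow] with x hx using ENNReal.ofReal_le_ofReal hx
    _ = ENNReal.ofReal (∫ x, (F x + a x ^ (p - 1) * d x) ∂ν) := by
        refine (ofReal_integral_eq_lintegral_ofReal (hFint.add hint_d) ?_).symm
        filter_upwards [hlow] with x hx
        refine le_trans ?_ hx
        exact Set.indicator_nonneg (fun x _ => Real.rpow_nonneg (ha0 x) _) x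
    _ ≤ ENNReal.ofReal (∫ x, F x ∂ν) + ENNReal.ofReal (∫ x, a x ^ (p - 1) * d x ∂ν) := by
        rw [integral_add hFint hint_d]
        exact ENNReal.ofReal_add_le
    _ ≤ _ := by
        gcongr
        · exact le_rfl
        · rw [ofReal_integral_eq_lintegral_ofReal hint_d (ae_of_all _ fun x => by
            have := ha0 x; have := hd0 x; positivity)]
          exact hHol d hdm hd0

/-- If the forcing tested with `(ψ - r)⁺` is at most `b^{p-1} ‖∇(ψ - r)⁺‖` and `∇ψ` is close to
`G`, then `‖∇(ψ - r)⁺‖` is at most a multiple of `b`. -/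
lemma QLpNorm_gradient_truncate_le_of_forcing_le (hΩ : MeasurableSet Ω) (hp : 1 < p)
    (hQ : IsPSDMatrixFunction Ω Q) (hG : AEMeasurable G (volume.restrict Ω))
    (hψ : Continuous ψ) (hGfin : QLpNorm Ω p Q G < ∞) {b : ℝ} (hb : 0 < b)
    (hd : QLpNorm Ω p Q (fun x => gradient ψ x - G x) ≤ ENNReal.ofReal (b / 2))
    (he : QLpNorm Ω p Q G ^ (p - 1) * QLpNorm Ω p Q (fun x => gradient ψ x - G x) ≤
      ENNReal.ofReal (b ^ p)) {r : ℝ}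
    (hw : ENNReal.ofReal (weakLHS Ω p Q G (fun y => max (ψ y - r) 0)) ≤
      ENNReal.ofReal (b ^ (p - 1)) * QLpNorm Ω p Q (gradient (fun y => max (ψ y - r) 0))) :
    QLpNorm Ω p Q (gradient (fun y => max (ψ y - r) 0)) ≤
      ENNReal.ofReal ((2 : ℝ) ^ ((p + 1) / (p - 1)) * b) := by
  have hd_fin := hd.trans_lt ENNReal.ofReal_lt_top
  have hmin := QLpNorm_gradient_truncate_le hΩ hp hQ hG hψ r
  have hen := (eLpNorm_rpow_le_weakLHS_add hΩ hp hQ hG hψ hGfin hd_fin r).trans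
    (add_le_add_left hw _)
  set x := QLpNorm Ω p Q (gradient (fun y => max (ψ y - r) 0))
  set X := eLpNorm (fun x => ‖sqrtMulVec (Q x) (G x)‖) (ENNReal.ofReal p)
    ((volume.restrict Ω).restrict {x | r < ψ x}) with hX
  set δ := QLpNorm Ω p Q (fun x => gradient ψ x - G x)
  set e := QLpNorm Ω p Q G ^ (p - 1) * δ
  have hX_fin : X < ∞ := by
    refine lt_of_le_of_lt ?_ hGfin
    rw [QLpNorm_eq_eLpNorm_norm]
    exact eLpNorm_mono_measure _ Measure.restrict_le_self
  have hx_fin : x < ∞ := hmin.trans_lt (ENNReal.add_lt_top.2 ⟨hX_fin, hd_fin⟩)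
  have he_fin : e < ∞ := he.trans_lt ENNReal.ofReal_lt_top
  rw [← ENNReal.ofReal_toReal hx_fin.ne]
  refine ENNReal.ofReal_le_ofReal (le_of_rpow_le_mul_add (X := X.toReal) (d := δ.toReal)
    (e := e.toReal) hp hb ?_ ?_ ?_ ?_)
  · exact ENNReal.toReal_le_of_le_ofReal (by positivity) hd
  · exact ENNReal.toReal_le_of_le_ofReal (by positivity) he
  · have := ENNReal.toReal_mono (ENNReal.add_lt_top.2
      ⟨ENNReal.mul_lt_top ENNReal.ofReal_lt_top hx_fin, he_fin⟩).ne hen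
    rwa [ENNReal.toReal_add (ENNReal.mul_lt_top ENNReal.ofReal_lt_top hx_fin).ne he_fin.ne,
      ENNReal.toReal_mul, ENNReal.toReal_ofReal (by positivity), ← ENNReal.toReal_rpow] at this
  · have := ENNReal.toReal_mono (ENNReal.add_lt_top.2 ⟨hX_fin, hd_fin⟩).ne hmin
    rwa [ENNReal.toReal_add hX_fin.ne hd_fin.ne] at this

end Truncation

/-! ### The decay of the superlevel sets -/

/-- One step of the De Giorgi iteration, with the forcing bound and the Sobolev inequality on sets
of measure at most `m` as hypotheses. The level is raised three times by `η`: once so that the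
truncated approximants live on a set of measure at most `m`, once to leave room for Chebyshev's
inequality, and once to return from the approximants to `u`. -/
lemma measure_superlevel_le {n : ℕ} {Ω : Set (E n)} (hΩ : MeasurableSet Ω) {p : ℝ} (hp : 1 < p)
    {Q : E n → Matrix (Fin n) (Fin n) ℝ} (hQ : IsPSDMatrixFunction Ω Q)
    {v f g u : E n → ℝ} {t G : E n → E n} (hu : MemQH0 Ω p Q v u G)
    (hsub : ∀ φ : E n → ℝ, IsLipZero Ω φ → (∀ x, 0 ≤ φ x) →
      ENNReal.ofReal (weakLHS Ω p Q G φ) ≤ forcing Ω p v f g t φ)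
    {r η b s : ℝ} {m : ℝ≥0∞} (hr : 0 ≤ r) (hη : 0 < η) (hb : 0 < b) (hs : 0 ≤ s)
    (hm : wMeasure Ω v {x | r < u x} < m)
    (hforcing : ∀ (φ : E n → ℝ) (A : Set (E n)), IsLipZero Ω φ → MeasurableSet A →
      (∀ x ∉ A, φ x = 0) → (∀ x ∉ A, gradient φ x = 0) → wMeasure Ω v A ≤ m →
      forcing Ω p v f g t φ ≤ ENNReal.ofReal (b ^ (p - 1)) * QLpNorm Ω p Q (gradient φ))
    (hsob : ∀ (φ : E n → ℝ) (A : Set (E n)), IsLipZero Ω φ → MeasurableSet A →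
      (∀ x ∉ A, φ x = 0) → wMeasure Ω v A ≤ m →
      eLpNorm φ (ENNReal.ofReal p) (wMeasure Ω v) ≤
        ENNReal.ofReal s * QLpNorm Ω p Q (gradient φ)) :
    wMeasure Ω v {x | r + 3 * η < u x} ≤
      ENNReal.ofReal ((s * ((2 : ℝ) ^ ((p + 1) / (p - 1)) * b) / η) ^ p) := by
  have hp0 : 0 < p := by linarith
  have hp1 : 0 < p - 1 := by linarith
  have hp0' : ENNReal.ofReal p ≠ 0 := by simpa using hp0
  obtain ⟨huLp, hG, hGfin, ψ, hψ, hψu, hψG⟩ := hu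
  set μ := wMeasure Ω v with hμ
  have hcont : ∀ j, Continuous (ψ j) := fun j => (hψ j).1.continuous
  have hmeas : Tendsto (fun j => μ {x | ENNReal.ofReal η ≤ edist (ψ j x) (u x)}) atTop (𝓝 0) :=
    tendstoInMeasure_of_tendsto_eLpNorm hp0' (fun j => (hcont j).aestronglyMeasurable)
      huLp.aestronglyMeasurable hψu (ENNReal.ofReal η) (by simpa using hη)
  have hdist : ∀ j x, |ψ j x - u x| < η ∨
      x ∈ {x | ENNReal.ofReal η ≤ edist (ψ j x) (u x)} := by
    intro j x
    rw [Set.mem_ofPred_eq, edist_dist, Real.dist_eq,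
      ENNReal.ofReal_le_ofReal_iff (abs_nonneg _)]
    exact lt_or_ge _ _
  have hsmall : ∀ᶠ j in atTop,
      μ {x | ENNReal.ofReal η ≤ edist (ψ j x) (u x)} + μ {x | r < u x} ≤ m := by
    have : Tendsto (fun j => μ {x | ENNReal.ofReal η ≤ edist (ψ j x) (u x)} + μ {x | r < u x})
        atTop (𝓝 (0 + μ {x | r < u x})) := hmeas.add tendsto_const_nhds
    rw [zero_add] at this
    exact (this.eventually (gt_mem_nhds hm)).mono fun j hj => hj.le
  have hd : ∀ᶠ j in atTop, QLpNorm Ω p Q (fun x => gradient (ψ j) x - G x) ≤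
      ENNReal.ofReal (b / 2) :=
    (hψG.eventually (gt_mem_nhds (by simpa using hb))).mono fun j hj => hj.le
  have he : ∀ᶠ j in atTop, QLpNorm Ω p Q G ^ (p - 1) *
      QLpNorm Ω p Q (fun x => gradient (ψ j) x - G x) ≤ ENNReal.ofReal (b ^ p) := by
    have : Tendsto (fun j => QLpNorm Ω p Q G ^ (p - 1) *
        QLpNorm Ω p Q (fun x => gradient (ψ j) x - G x)) atTop
        (𝓝 (QLpNorm Ω p Q G ^ (p - 1) * 0)) :=
      ENNReal.Tendsto.const_mul hψG
        (Or.inr (ENNReal.rpow_lt_top_of_nonneg hp1.le hGfin.ne).ne)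
    rw [mul_zero] at this
    exact (this.eventually (gt_mem_nhds (by simp; positivity))).mono fun j hj => hj.le
  have hfinal : ∀ᶠ j in atTop, μ {x | r + 3 * η < u x} ≤
      μ {x | ENNReal.ofReal η ≤ edist (ψ j x) (u x)} +
        ENNReal.ofReal ((s * ((2 : ℝ) ^ ((p + 1) / (p - 1)) * b) / η) ^ p) := by
    filter_upwards [hsmall, hd, he] with j hsmall hd he
    set φ : E n → ℝ := fun x => max (ψ j x - (r + η)) 0 with hφ
    set A : Set (E n) := {x | r + η < ψ j x} with hA
    have hAm : MeasurableSet A := (isOpen_lt continuous_const (hcont j)).measurableSet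
    have hφlip : IsLipZero Ω φ := (hψ j).truncate (by linarith)
    have hAc : ∀ x ∉ A, ψ j x ≤ r + η := fun x hx => not_lt.1 (show ¬ r + η < ψ j x from hx)
    have hφ0 : ∀ x ∉ A, φ x = 0 := fun x hx => max_eq_right (by linarith [hAc x hx])
    have hφ1 : ∀ x ∉ A, gradient φ x = 0 := fun x hx => gradient_truncate_of_le (hAc x hx)
    have hAμ : μ A ≤ m := by
      refine le_trans (le_trans (measure_mono ?_) (measure_union_le _ _)) hsmall
      intro x hx
      rcases hdist j x with h | h
      · right
        have h1 : r + η < ψ j x := hx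
        have h2 := (abs_lt.1 h).2
        simp only [Set.mem_ofPred_eq]
        linarith
      · exact Or.inl h
    have hgrad : QLpNorm Ω p Q (gradient φ) ≤
        ENNReal.ofReal ((2 : ℝ) ^ ((p + 1) / (p - 1)) * b) :=
      QLpNorm_gradient_truncate_le_of_forcing_le hΩ hp hQ hG (hcont j) hGfin hb hd he
        ((hsub φ hφlip fun x => le_max_right _ _).trans (hforcing φ A hφlip hAm hφ0 hφ1 hAμ))
    have hY : eLpNorm φ (ENNReal.ofReal p) μ ≤
        ENNReal.ofReal (s * ((2 : ℝ) ^ ((p + 1) / (p - 1)) * b)) := by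
      rw [ENNReal.ofReal_mul hs]
      exact (hsob φ A hφlip hAm hφ0 hAμ).trans (by gcongr)
    have hcheb : μ {x | ENNReal.ofReal η ≤ ‖φ x‖ₑ} ≤
        ENNReal.ofReal ((s * ((2 : ℝ) ^ ((p + 1) / (p - 1)) * b) / η) ^ p) := by
      have h1 := meas_ge_le_mul_pow_eLpNorm_enorm μ hp0' ENNReal.ofReal_ne_top
        (hφlip.1.continuous.aestronglyMeasurable (μ := μ)) (ε := ENNReal.ofReal η)
        (by simpa using hη) (fun h => absurd h ENNReal.ofReal_ne_top)
      rw [ENNReal.toReal_ofReal hp0.le, ← ENNReal.mul_rpow_of_nonneg _ _ hp0.le] at h1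
      refine h1.trans ?_
      rw [← ENNReal.ofReal_rpow_of_nonneg (by positivity) hp0.le, ENNReal.ofReal_div_of_pos hη,
        ENNReal.div_eq_inv_mul]
      gcongr
    refine le_trans (measure_mono ?_) ((measure_union_le _ _).trans (add_le_add_right hcheb _))
    intro x hx
    rcases hdist j x with h | h
    · right
      have h1 : r + 3 * η < u x := hx
      have h2 := (abs_lt.1 h).1
      simp only [Set.mem_ofPred_eq]
      rw [Real.enorm_of_nonneg (le_max_right _ _)]
      exact ENNReal.ofReal_le_ofReal (le_max_of_le_left (by linarith))
    · exact Or.inl h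
  have hlim : Tendsto (fun j => μ {x | ENNReal.ofReal η ≤ edist (ψ j x) (u x)} +
        ENNReal.ofReal ((s * ((2 : ℝ) ^ ((p + 1) / (p - 1)) * b) / η) ^ p)) atTop
      (𝓝 (0 + ENNReal.ofReal ((s * ((2 : ℝ) ^ ((p + 1) / (p - 1)) * b) / η) ^ p))) :=
    hmeas.add tendsto_const_nhds
  rw [zero_add] at hlim
  exact ge_of_tendsto hlim hfinal

/-- The bound for subsolutions. The hypothesis on the weak form is stated with `forcing`, so that
it covers subsolutions `u` and the negatives of supersolutions alike. -/
lemma exists_measure_superlevel_eq_zero {n : ℕ} {Ω : Set (E n)} (hΩ : MeasurableSet Ω)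
    {v : E n → ℝ} (hv : IntegrableOn v Ω) {p σ α β : ℝ} (hp : 1 < p) (hσ : p < σ)
    (hα : p * (p - 1) / σ < α) (hβ : p / (σ - p) < β) (S K : ℝ≥0) :
    ∃ C : ℝ≥0, ∀ (Q : E n → Matrix (Fin n) (Fin n) ℝ) (t : E n → E n),
      IsPSDMatrixFunction Ω Q → SobolevInequality Ω p Q v (logBump p σ) S →
      IsSubunit Ω p Q v t K →
      ∀ (f g : E n → ℝ), AEMeasurable f (wMeasure Ω v) → AEMeasurable g (wMeasure Ω v) →
      ∀ R : ℝ, 0 < R →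
      luxemburgNorm (expYoung α) (wMeasure Ω v) f ≤ ENNReal.ofReal R →
      luxemburgNorm (expYoung β) (wMeasure Ω v) g ≤ ENNReal.ofReal R →
      ∀ (u : E n → ℝ) (G : E n → E n), MemQH0 Ω p Q v u G →
      (∀ φ : E n → ℝ, IsLipZero Ω φ → (∀ x, 0 ≤ φ x) →
        ENNReal.ofReal (weakLHS Ω p Q G φ) ≤ forcing Ω p v f g t φ) →
      wMeasure Ω v {x | C * R < u x} = 0 := by
  have hp0 : 0 < p := by linarith
  have hp1 : 0 < p - 1 := by linarith
  have hσ0 : 0 < σ := by linarith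
  have hα0 : 0 < α := lt_of_le_of_lt (by positivity) hα
  have hσp : 0 < σ - p := by linarith
  have hβ0 : 0 < β := lt_of_le_of_lt (by positivity) hβ
  set μ := wMeasure Ω v with hμ
  have hμfin : μ Set.univ < ∞ := by
    rw [hμ, wMeasure, withDensity_apply _ MeasurableSet.univ, Measure.restrict_univ]
    exact Integrable.lintegral_lt_top hv
  obtain ⟨M, hM1, hMμ⟩ : ∃ M : ℝ, 1 ≤ M ∧ μ Set.univ ≤ ENNReal.ofReal M := by
    refine ⟨(μ Set.univ).toReal + 1, by linarith [ENNReal.toReal_nonneg (a := μ Set.univ)], ?_⟩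
    refine (ENNReal.ofReal_toReal hμfin.ne).symm.le.trans (ENNReal.ofReal_le_ofReal (by linarith))
  have hM0 : 0 < M := by linarith
  -- with `l = k + 1`, `m₀ e^{-l} = 2 M e^{-k}`: twice the measure allowed to the `k`-th superlevel
  -- set of `u`, which leaves room for those of the approximants
  set m₀ := 2 * M * Real.exp 1 with hm₀
  have hm₀0 : 0 < m₀ := by positivity
  obtain ⟨C₁, hC₁, hf_exp⟩ := exists_eLpNorm_le_expYoung hp0 hα0 hm₀0
  obtain ⟨C₂, hC₂, hg_exp⟩ := exists_eLpNorm_le_expYoung hp0 hβ0 hm₀0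
  obtain ⟨C₃, hC₃, hlog⟩ := exists_eLpNorm_le_logBump hp0 hσ0 hm₀0
  -- `H ^ (1 / (p - 1))` is the constant in the gradient bound, `D` the one in the increments of
  -- the levels
  set H := C₁ ^ (p - 1) * (C₃ * S) + C₂ ^ (p - 1) * K + 1 with hH
  have hH0 : 0 < H := by positivity
  set L := (2 : ℝ) ^ ((p + 1) / (p - 1)) with hL
  have hL0 : 0 < L := by positivity
  set D := C₃ * S * (L * H ^ (1 / (p - 1))) + 1 with hD
  have hD0 : 0 < D := by positivity
  -- the increments of the levels are multiples of `l ^ (-θ)`, which is summable as `θ > 1`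
  set θ := σ / p - 1 / β with hθ
  have hθ1 : 1 < θ := by
    have h1 : 1 / β < (σ - p) / p := by
      rw [div_lt_div_iff₀ hβ0 hp0, one_mul]
      rwa [div_lt_iff₀ hσp, mul_comm] at hβ
    have h2 : (σ - p) / p = σ / p - 1 := by field_simp
    rw [hθ]; linarith
  have hαexp : (p - 1) / α ≤ σ / p := by
    rw [div_le_div_iff₀ hα0 hp0]
    rw [div_lt_iff₀ hσ0] at hα
    linarith
  have hsum : Summable fun i : ℕ => ((i : ℝ) + 1) ^ (-θ) := by
    have := (summable_nat_add_iff 1).2 (Real.summable_nat_rpow.2 (by linarith : -θ < -1))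
    simpa using this
  set T := ∑' i : ℕ, ((i : ℝ) + 1) ^ (-θ) with hT
  have hT0 : 0 ≤ T := tsum_nonneg fun i => by positivity
  refine ⟨⟨3 * D * T, by positivity⟩, ?_⟩
  intro Q t hQ hSob ht f g hf hg R hR hfR hgR u G hu hsub
  -- the levels of the iteration
  set ρ : ℕ → ℝ := fun k => ∑ i ∈ Finset.range k, 3 * (D * R * ((i : ℝ) + 1) ^ (-θ)) with hρ
  have hρ0 : ∀ k, 0 ≤ ρ k := fun k => Finset.sum_nonneg fun i _ => by positivity
  have hdecay : ∀ k : ℕ, μ {x | ρ k < u x} ≤ ENNReal.ofReal (M * Real.exp (-(k : ℝ))) := by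
    intro k
    induction k with
    | zero =>
      refine (measure_mono (Set.subset_univ _)).trans (hMμ.trans_eq ?_)
      simp
    | succ k ih =>
      set l : ℝ := (k : ℝ) + 1 with hl
      have hl1 : 1 ≤ l := by rw [hl]; linarith [Nat.cast_nonneg (α := ℝ) k]
      have hl0 : 0 < l := by linarith
      set b := H ^ (1 / (p - 1)) * l ^ (1 / β) * Real.exp (-l / p) * R with hb
      set s := C₃ * l ^ (-σ / p) * S with hs
      set m := ENNReal.ofReal (m₀ * Real.exp (-l)) with hm
      have hb0 : 0 < b := by positivity
      have hs0 : 0 ≤ s := by positivity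
      have hη0 : 0 < D * R * l ^ (-θ) := by positivity
      have hm_lt : μ {x | ρ k < u x} < m := by
        refine ih.trans_lt ?_
        rw [hm, ENNReal.ofReal_lt_ofReal_iff (by positivity)]
        have : m₀ * Real.exp (-l) = 2 * (M * Real.exp (-(k : ℝ))) := by
          have h1 : Real.exp (-(k : ℝ)) = Real.exp 1 * Real.exp (-l) := by
            rw [← Real.exp_add, hl]; congr 1; ring
          rw [hm₀, h1]; ring
        have h2 : 0 < M * Real.exp (-(k : ℝ)) := by positivity
        linarith
      have hsob : ∀ (φ : E n → ℝ) (A : Set (E n)), IsLipZero Ω φ → MeasurableSet A →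
          (∀ x ∉ A, φ x = 0) → μ A ≤ m →
          eLpNorm φ (ENNReal.ofReal p) μ ≤
            ENNReal.ofReal s * QLpNorm Ω p Q (gradient φ) := by
        intro φ A hφ hA hφ0 hAm
        have hind : A.indicator φ = φ :=
          Set.indicator_eq_self.2 fun x hx => by_contra fun hxA => hx (hφ0 x hxA)
        have h1 := hlog n μ A l φ hl0 hAm
        rw [← eLpNorm_indicator_eq_eLpNorm_restrict hA, hind] at h1
        refine (h1.trans (mul_le_mul_right (hSob φ hφ) _)).trans_eq ?_
        rw [hs, ENNReal.ofReal_mul (show 0 ≤ C₃ * l ^ (-σ / p) by positivity),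
          ENNReal.ofReal_coe_nnreal, mul_assoc]
      have hforcing : ∀ (φ : E n → ℝ) (A : Set (E n)), IsLipZero Ω φ → MeasurableSet A →
          (∀ x ∉ A, φ x = 0) → (∀ x ∉ A, gradient φ x = 0) → μ A ≤ m →
          forcing Ω p v f g t φ ≤
            ENNReal.ofReal (b ^ (p - 1)) * QLpNorm Ω p Q (gradient φ) := by
        intro φ A hφ hA hφ0 hφ1 hAm
        have hf1 := (hf_exp n μ A l f hl1 hAm).trans (mul_le_mul_right hfR _)
        have hg1 := (hg_exp n μ A l g hl1 hAm).trans (mul_le_mul_right hgR _)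
        rw [← ENNReal.ofReal_mul (by positivity)] at hf1 hg1
        set F := C₁ * l ^ (1 / α) * Real.exp (-l / p) * R with hF
        set Γ := C₂ * l ^ (1 / β) * Real.exp (-l / p) * R with hΓ
        have hF0 : 0 < F := by positivity
        have hΓ0 : 0 < Γ := by positivity
        -- the exponent `(p - 1) / α - σ / p` of `l` in the contribution of `f` is nonpositive
        have hreal : F ^ (p - 1) * s + Γ ^ (p - 1) * K ≤ b ^ (p - 1) := by
          set e := Real.exp (-l / p) with he
          have he0 : 0 < e := by positivity
          have hβl : ∀ c : ℝ, 0 ≤ c → (c * l ^ (1 / β) * e * R) ^ (p - 1)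
              = c ^ (p - 1) * (l ^ ((p - 1) / β) * (e * R) ^ (p - 1)) := by
            intro c hc
            rw [mul_assoc, Real.mul_rpow (by positivity) (by positivity),
              Real.mul_rpow hc (by positivity), ← Real.rpow_mul hl0.le, mul_assoc]
            congr 3
            ring
          have hFs : F ^ (p - 1) * s = C₁ ^ (p - 1) * (C₃ * S) *
              (l ^ ((p - 1) / α - σ / p) * (e * R) ^ (p - 1)) := by
            rw [hF, hs, mul_assoc (C₁ * _) e R, Real.mul_rpow (by positivity) (by positivity),
              Real.mul_rpow hC₁.le (by positivity), ← Real.rpow_mul hl0.le,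
              Real.rpow_sub hl0, show 1 / α * (p - 1) = (p - 1) / α by ring,
              show -σ / p = -(σ / p) by ring, Real.rpow_neg hl0.le]
            ring
          have h1 : l ^ ((p - 1) / α - σ / p) ≤ 1 :=
            Real.rpow_le_one_of_one_le_of_nonpos hl1 (by linarith)
          have h2 : 1 ≤ l ^ ((p - 1) / β) := Real.one_le_rpow hl1 (by positivity)
          have h3 : 0 < (e * R) ^ (p - 1) := by positivity
          have hHpow : (H ^ (1 / (p - 1))) ^ (p - 1) = H := by
            rw [← Real.rpow_mul hH0.le, one_div_mul_cancel hp1.ne', Real.rpow_one]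
          rw [hFs, hΓ, hb, hβl _ hC₂.le, hβl _ (by positivity), hHpow, hH]
          set Z := l ^ ((p - 1) / β) * (e * R) ^ (p - 1) with hZ
          have hZ0 : 0 < Z := by positivity
          have h4 : l ^ ((p - 1) / α - σ / p) * (e * R) ^ (p - 1) ≤ Z :=
            mul_le_mul_of_nonneg_right (h1.trans h2) h3.le
          have h5 : C₁ ^ (p - 1) * (C₃ * S) *
              (l ^ ((p - 1) / α - σ / p) * (e * R) ^ (p - 1)) ≤ C₁ ^ (p - 1) * (C₃ * S) * Z := by
            gcongr
          linarith
        calc forcing Ω p v f g t φ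
            ≤ _ := forcing_le hp hf hg ht.1 hφ.1.continuous hφ0 hφ1
          _ ≤ ENNReal.ofReal F ^ (p - 1) *
                (ENNReal.ofReal s * QLpNorm Ω p Q (gradient φ))
              + ENNReal.ofReal Γ ^ (p - 1) * (ENNReal.ofReal K * QLpNorm Ω p Q (gradient φ)) := by
              gcongr
              · exact hsob φ A hφ hA hφ0 hAm
              · exact (ht.2 φ hφ).trans_eq (by rw [ENNReal.ofReal_coe_nnreal])
          _ = ENNReal.ofReal (F ^ (p - 1) * s + Γ ^ (p - 1) * K) *
                QLpNorm Ω p Q (gradient φ) := by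
              rw [ENNReal.ofReal_add (by positivity) (by positivity),
                ENNReal.ofReal_mul (Real.rpow_nonneg hF0.le (p - 1)),
                ENNReal.ofReal_mul (Real.rpow_nonneg hΓ0.le (p - 1)),
                ENNReal.ofReal_rpow_of_nonneg hF0.le hp1.le,
                ENNReal.ofReal_rpow_of_nonneg hΓ0.le hp1.le]
              ring
          _ ≤ _ := by gcongr
      have hstep := measure_superlevel_le hΩ hp hQ hu hsub (hρ0 k) hη0 hb0 hs0 hm_lt
        hforcing hsob
      have hρs : ρ (k + 1) = ρ k + 3 * (D * R * l ^ (-θ)) := Finset.sum_range_succ _ _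
      rw [hρs]
      refine hstep.trans (ENNReal.ofReal_le_ofReal ?_)
      have hquot : s * (L * b) / (D * R * l ^ (-θ)) ≤ Real.exp (-l / p) := by
        rw [div_le_iff₀ hη0]
        have h1 : s * (L * b) = C₃ * S * (L * H ^ (1 / (p - 1))) *
            (l ^ (-σ / p) * l ^ (1 / β)) * (Real.exp (-l / p) * R) := by
          rw [hs, hb]; ring
        have h2 : l ^ (-σ / p) * l ^ (1 / β) = l ^ (-θ) := by
          rw [← Real.rpow_add hl0, hθ]; congr 1; ring
        rw [h1, h2]
        calc C₃ * S * (L * H ^ (1 / (p - 1))) * l ^ (-θ) * (Real.exp (-l / p) * R)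
            ≤ D * l ^ (-θ) * (Real.exp (-l / p) * R) := by
              gcongr
              rw [hD]; linarith
          _ = _ := by ring
      calc (s * (L * b) / (D * R * l ^ (-θ))) ^ p ≤ Real.exp (-l / p) ^ p := by gcongr
        _ = Real.exp (-l) := by rw [← Real.exp_mul]; congr 1; field_simp
        _ ≤ M * Real.exp (-l) := le_mul_of_one_le_left (by positivity) hM1
        _ = _ := by rw [hl]; push_cast; rfl
  have hρT : ∀ k, ρ k ≤ 3 * D * T * R := by
    intro k
    have h1 : ρ k = 3 * D * R * ∑ i ∈ Finset.range k, ((i : ℝ) + 1) ^ (-θ) := by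
      rw [hρ, Finset.mul_sum]
      exact Finset.sum_congr rfl fun i _ => by ring
    have h2 : ∑ i ∈ Finset.range k, ((i : ℝ) + 1) ^ (-θ) ≤ T :=
      hsum.sum_le_tsum _ fun i _ => by positivity
    rw [h1]
    calc 3 * D * R * ∑ i ∈ Finset.range k, ((i : ℝ) + 1) ^ (-θ) ≤ 3 * D * R * T := by gcongr
      _ = _ := by ring
  have hlim : Tendsto (fun k : ℕ => ENNReal.ofReal (M * Real.exp (-(k : ℝ)))) atTop (𝓝 0) := by
    have h1 : Tendsto (fun k : ℕ => M * Real.exp (-(k : ℝ))) atTop (𝓝 (M * 0)) :=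
      (Real.tendsto_exp_neg_atTop_nhds_zero.comp tendsto_natCast_atTop_atTop).const_mul M
    simpa using ENNReal.tendsto_ofReal h1
  refine le_antisymm (ge_of_tendsto' hlim fun k => ?_) bot_le
  refine (measure_mono fun x hx => ?_).trans (hdecay k)
  exact lt_of_le_of_lt (hρT k) hx

/-! ### Subsolutions, supersolutions and solutions -/

lemma MemQH0.neg {n : ℕ} {Ω : Set (E n)} {p : ℝ} {Q : E n → Matrix (Fin n) (Fin n) ℝ}
    {v u : E n → ℝ} {G : E n → E n} (h : MemQH0 Ω p Q v u G) : MemQH0 Ω p Q v (-u) (-G) := by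
  obtain ⟨hu, hG, hGfin, ψ, hψ, hψu, hψG⟩ := h
  have hneg : ∀ F : E n → E n, QLpNorm Ω p Q (fun x => -F x) = QLpNorm Ω p Q F := by
    intro F
    simp only [QLpNorm, map_neg]
    exact eLpNorm_neg (fun x => sqrtMulVec (Q x) (F x)) _ _
  refine ⟨hu.neg, hG.neg, (hneg G).trans_lt hGfin, fun j => -ψ j, fun j => (hψ j).neg, ?_, ?_⟩
  · refine hψu.congr fun j => ?_
    rw [← eLpNorm_neg]
    congr 1
    funext x
    simp only [Pi.neg_apply]
    ring
  · refine hψG.congr fun j => ?_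
    rw [← hneg]
    congr 1
    funext x
    rw [gradient_neg_apply, Pi.neg_apply]
    abel

lemma weakLHS_neg {n : ℕ} (Ω : Set (E n)) (p : ℝ) (Q : E n → Matrix (Fin n) (Fin n) ℝ)
    (G : E n → E n) (φ : E n → ℝ) : weakLHS Ω p Q (-G) φ = -weakLHS Ω p Q G φ := by
  simp only [weakLHS, Pi.neg_apply, map_neg, norm_neg, inner_neg_right, mul_neg]
  exact integral_neg _

lemma IsWeakSolution.isWeakSubsolution {n : ℕ} {Ω : Set (E n)} {p : ℝ}
    {Q : E n → Matrix (Fin n) (Fin n) ℝ} {v f g u : E n → ℝ} {t G : E n → E n}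
    (h : IsWeakSolution Ω p Q v f g t u G) : IsWeakSubsolution Ω p Q v f g t u G :=
  ⟨h.1, fun φ hφ _ => (h.2 φ hφ).le⟩

lemma IsWeakSolution.isWeakSupersolution {n : ℕ} {Ω : Set (E n)} {p : ℝ}
    {Q : E n → Matrix (Fin n) (Fin n) ℝ} {v f g u : E n → ℝ} {t G : E n → E n}
    (h : IsWeakSolution Ω p Q v f g t u G) : IsWeakSupersolution Ω p Q v f g t u G :=
  ⟨h.1, fun φ hφ _ => (h.2 φ hφ).ge⟩

/-- A bound that holds for every real `R > N` holds for `N`, in the form used for `L^∞` norms. -/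
lemma eLpNorm_top_le_of_forall_gt {X : Type*} [MeasurableSpace X] {μ : Measure X} {w : X → ℝ}
    {C : ℝ≥0} {N : ℝ≥0∞} (hN : N < ∞)
    (h : ∀ R : ℝ, 0 < R → N ≤ ENNReal.ofReal R → ∀ᵐ x ∂μ, |w x| ≤ C * R) :
    eLpNorm w ∞ μ ≤ C * N := by
  have hlim : Tendsto (fun ε : ℝ => ENNReal.ofReal (C * (N.toReal + ε))) (𝓝[>] 0)
      (𝓝 (ENNReal.ofReal (C * (N.toReal + 0)))) := by
    refine ENNReal.tendsto_ofReal (Tendsto.const_mul _ (Tendsto.const_add _ ?_))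
    exact tendsto_id.mono_left nhdsWithin_le_nhds
  have hN' : ENNReal.ofReal (C * (N.toReal + 0)) = C * N := by
    rw [add_zero, ENNReal.ofReal_mul C.coe_nonneg, ENNReal.ofReal_coe_nnreal, ENNReal.ofReal_toReal hN.ne]
  rw [hN'] at hlim
  refine ge_of_tendsto hlim ?_
  filter_upwards [self_mem_nhdsWithin] with ε hε
  have hε0 : 0 < ε := hε
  have hR0 : 0 < N.toReal + ε := by linarith [ENNReal.toReal_nonneg (a := N)]
  have hR : N ≤ ENNReal.ofReal (N.toReal + ε) := by
    conv_lhs => rw [← ENNReal.ofReal_toReal hN.ne]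
    exact ENNReal.ofReal_le_ofReal (by linarith)
  rw [eLpNorm_exponent_top]
  refine essSup_le_of_ae_le _ ?_
  filter_upwards [h _ hR0 hR] with x hx
  rw [Real.enorm_eq_ofReal_abs]
  exact ENNReal.ofReal_le_ofReal hx

end DegenerateDirichlet

open MeasureTheory DegenerateDirichlet

theorem mainTheorem2 (n : ℕ) (Ω : Set (DegenerateDirichlet.E n))
    (hΩ_open : IsOpen Ω) (hΩ_conn : IsConnected Ω) (hΩ_bdd : Bornology.IsBounded Ω)
    (v : DegenerateDirichlet.E n → ℝ) (hv_nonneg : ∀ x ∈ Ω, 0 ≤ v x)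
    (hv_int : MeasureTheory.IntegrableOn v Ω)
    (p σ α β : ℝ) (hp : 1 < p) (hσ : p < σ)
    (hα : p * (p - 1) / σ < α) (hβ : p / (σ - p) < β)
    (S K : ℝ≥0) :
    ∃ C : ℝ≥0,
      ∀ (Q : DegenerateDirichlet.E n → Matrix (Fin n) (Fin n) ℝ) (k : ℝ)
        (t : DegenerateDirichlet.E n → DegenerateDirichlet.E n),
        DegenerateDirichlet.IsPSDMatrixFunction Ω Q →
        DegenerateDirichlet.IsDominated Ω p Q v k →
        DegenerateDirichlet.SobolevInequality Ω p Q v (DegenerateDirichlet.logBump p σ) S →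
        DegenerateDirichlet.IsSubunit Ω p Q v t K →
      ∀ f g : DegenerateDirichlet.E n → ℝ,
        DegenerateDirichlet.MemOrlicz (DegenerateDirichlet.expYoung α)
          (DegenerateDirichlet.wMeasure Ω v) f →
        DegenerateDirichlet.MemOrlicz (DegenerateDirichlet.expYoung β)
          (DegenerateDirichlet.wMeasure Ω v) g →
      ∀ (u : DegenerateDirichlet.E n → ℝ)
        (G : DegenerateDirichlet.E n → DegenerateDirichlet.E n),
        (DegenerateDirichlet.IsWeakSubsolution Ω p Q v f g t u G →
          MeasureTheory.eLpNorm (fun x => max (u x) 0) ∞ (DegenerateDirichlet.wMeasure Ω v) ≤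
            C * (DegenerateDirichlet.luxemburgNorm (DegenerateDirichlet.expYoung α)
                  (DegenerateDirichlet.wMeasure Ω v) f
                + DegenerateDirichlet.luxemburgNorm (DegenerateDirichlet.expYoung β)
                  (DegenerateDirichlet.wMeasure Ω v) g)) ∧
        (DegenerateDirichlet.IsWeakSupersolution Ω p Q v f g t u G →
          MeasureTheory.eLpNorm (fun x => max (-u x) 0) ∞ (DegenerateDirichlet.wMeasure Ω v) ≤
            C * (DegenerateDirichlet.luxemburgNorm (DegenerateDirichlet.expYoung α)
                  (DegenerateDirichlet.wMeasure Ω v) f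
                + DegenerateDirichlet.luxemburgNorm (DegenerateDirichlet.expYoung β)
                  (DegenerateDirichlet.wMeasure Ω v) g)) ∧
        (DegenerateDirichlet.IsWeakSolution Ω p Q v f g t u G →
          MeasureTheory.MemLp u ∞ (DegenerateDirichlet.wMeasure Ω v) ∧
          MeasureTheory.eLpNorm u ∞ (DegenerateDirichlet.wMeasure Ω v) ≤
            C * (DegenerateDirichlet.luxemburgNorm (DegenerateDirichlet.expYoung α)
                  (DegenerateDirichlet.wMeasure Ω v) f
                + DegenerateDirichlet.luxemburgNorm (DegenerateDirichlet.expYoung β)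
                  (DegenerateDirichlet.wMeasure Ω v) g)) := by
  obtain ⟨C, hC⟩ := exists_measure_superlevel_eq_zero hΩ_open.measurableSet hv_int hp hσ hα hβ S K
  refine ⟨C, ?_⟩
  intro Q k t hQ _ hSob ht f g hf hg u G
  have hNf := hf.2
  have hNg := hg.2
  set N := luxemburgNorm (expYoung α) (wMeasure Ω v) f
    + luxemburgNorm (expYoung β) (wMeasure Ω v) g with hN
  have hN_fin : N < ∞ := ENNReal.add_lt_top.2 ⟨hNf, hNg⟩
  have hsub : IsWeakSubsolution Ω p Q v f g t u G → ∀ R : ℝ, 0 < R → N ≤ ENNReal.ofReal R →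
      ∀ᵐ x ∂(wMeasure Ω v), u x ≤ C * R := by
    intro h R hR hNR
    have h0 := hC Q t hQ hSob ht f g hf.1 hg.1 R hR (le_self_add.trans hNR)
      (le_add_self.trans hNR) u G h.1 fun φ hφ hφ0 =>
        (ENNReal.ofReal_le_ofReal ((h.2 φ hφ hφ0).trans (le_abs_self _))).trans
          ((Real.enorm_eq_ofReal_abs _).symm.le.trans (enorm_weakRHS_le_forcing hp v f g t φ))
    filter_upwards [measure_eq_zero_iff_ae_notMem.1 h0] with x hx using
      not_lt.1 (show ¬ C * R < u x from hx)
  have hsuper : IsWeakSupersolution Ω p Q v f g t u G → ∀ R : ℝ, 0 < R → N ≤ ENNReal.ofReal R →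
      ∀ᵐ x ∂(wMeasure Ω v), -u x ≤ C * R := by
    intro h R hR hNR
    have h0 := hC Q t hQ hSob ht f g hf.1 hg.1 R hR (le_self_add.trans hNR)
      (le_add_self.trans hNR) (-u) (-G) h.1.neg fun φ hφ hφ0 => by
        rw [weakLHS_neg]
        exact (ENNReal.ofReal_le_ofReal ((neg_le_neg (h.2 φ hφ hφ0)).trans (neg_le_abs _))).trans
          ((Real.enorm_eq_ofReal_abs _).symm.le.trans (enorm_weakRHS_le_forcing hp v f g t φ))
    filter_upwards [measure_eq_zero_iff_ae_notMem.1 h0] with x hx using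
      not_lt.1 (show ¬ C * R < -u x from hx)
  refine ⟨fun h => ?_, fun h => ?_, fun h => ?_⟩
  · refine eLpNorm_top_le_of_forall_gt hN_fin fun R hR hNR => ?_
    filter_upwards [hsub h R hR hNR] with x hx
    rw [abs_of_nonneg (le_max_right _ _)]
    exact max_le hx (by positivity)
  · refine eLpNorm_top_le_of_forall_gt hN_fin fun R hR hNR => ?_
    filter_upwards [hsuper h R hR hNR] with x hx
    rw [abs_of_nonneg (le_max_right _ _)]
    exact max_le hx (by positivity)
  · have hbound : eLpNorm u ∞ (wMeasure Ω v) ≤ C * N := by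
      refine eLpNorm_top_le_of_forall_gt hN_fin fun R hR hNR => ?_
      filter_upwards [hsub h.isWeakSubsolution R hR hNR,
        hsuper h.isWeakSupersolution R hR hNR] with x hx hx'
      exact abs_le.2 ⟨by linarith, hx⟩
    exact ⟨⟨h.1.1.1, hbound.trans_lt (ENNReal.mul_lt_top ENNReal.coe_lt_top hN_fin)⟩, hbound⟩
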